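/- Consider a queue with Poisson arrivals of rate $\lambda>0$, an infinite waiting room, and $K$ groups of parallel exponential servers; group $k$ has $M_k$ servers, each with service rate $\mu_k>0$ and operating cost rate $c_k\ge 0$ while turned on. Customers may migrate freely between servers, and turning servers on and off costs nothing. The state is the number $n\in\mathbb N$ of customers in the system, and $h(n)$ is the holding cost rate, where $h:\mathbb N\to\mathbb R$ is nondecreasing and convex with $h(n)\to\infty$. An efficient stationary policy $d$ assigns to every state $n$ a vector $d(n)=(d(n,1),\dots,d(n,K))$ of integers $0\le d(n,k)\le M_k$ with $\sum_k d(n,k)\le n$, the numbers of working servers. Under $d$ the number $n_t$ of customers at time $t$ is a birth-death process with birth rate $\lambda$ and death rate $\sum_k d(n,k)\mu_k$ in state $n$; denote its generator by $B$. The cost rate in state $n$ is $f(n,d(n))=h(n)+\sum_k d(n,k)c_k$, and the long-run average cost is $\eta^d=\lim_{T\to\infty}\mathbb E\{\frac1T\int_0^T f(n_t,d(n_t))\,dt\}$. Let $d^*$ be an optimal policy, that is, one that minimizes $\eta^d$ over all efficient policies, and suppose that $\eta^*=\eta^{d^*}$ is finite. Let $g^*$ be the performance potential of $d^*$, that is,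 $g^*(n)=\lim_{T\to\infty}\mathbb E\{\int_0^T [f(n_t,d^*(n_t))-\eta^*]\,dt \mid n_0=n\}$ if these limits exist and are finite for all $n$, or, more generally, any solution $g^*:\mathbb N\to\mathbb R$ of the Poisson equation $f(n,d^*(n))-\eta^*+\sum_{m}B(n,m)g^*(m)=0$, $n\in\mathbb N$. Then the perturbation realization factor $G^*(n)=g^*(n)-g^*(n-1)$, $n\ge1$, is nonnegative and nondecreasing in $n$: $G^*(n)\ge 0$ and $G^*(n+1)\ge G^*(n)$ for all $n\ge1$. -/

import Mathlib

noncomputable section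

/-- A group-server queue with `K` groups of parallel exponential servers: Poisson arrivals with rate
`arr`; group `k` consists of `M k` servers, each with service rate `mu k` and with operating cost
rate `c k` while it is on; `h n` is the holding cost rate with `n` customers in the system, which is
increasing, convex and unbounded.  Switching servers on and off costs nothing. -/
structure GroupServerQueue (K : ℕ) where
  arr : ℝ
  M : Fin K → ℕ
  mu : Fin K → ℝ
  c : Fin K → ℝ
  h : ℕ → ℝ
  arr_pos : 0 < arr
  mu_pos : ∀ k, 0 < mu k
  c_nonneg : ∀ k, 0 ≤ c k
  h_mono : Monotone h
  h_convex : ∀ n, h (n + 1) - h n ≤ h (n + 2) - h (n + 1)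
  h_tendsto : Filter.Tendsto h Filter.atTop Filter.atTop

namespace GroupServerQueue

variable {K : ℕ} (q : GroupServerQueue K)

/-- A stationary policy `d` (with `d n k` servers of group `k` on in state `n`) is efficient if in
every state it respects the group sizes and turns on no more servers than there are customers. -/
def IsEfficient (d : ℕ → Fin K → ℕ) : Prop :=
  ∀ n, (∀ k, d n k ≤ q.M k) ∧ ∑ k, d n k ≤ n

/-- Total service rate of the action `m`. -/
def serviceRate (m : Fin K → ℕ) : ℝ := ∑ k, (m k : ℝ) * q.mu k

/-- Total cost rate in state `n` under the action `m`: holding cost plus operating cost. -/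
def costRate (n : ℕ) (m : Fin K → ℕ) : ℝ := q.h n + ∑ k, (m k : ℝ) * q.c k

/-- Generator of the birth-death process of the number of customers under the policy `d`.
(For an efficient policy the service rate in state `0` is `0`.) -/
def generator (d : ℕ → Fin K → ℕ) (n m : ℕ) : ℝ :=
  if m = n + 1 then q.arr
  else if m + 1 = n then q.serviceRate (d n)
  else if m = n then -(q.arr + q.serviceRate (d n))
  else 0

/-- A bound on the total transition rate out of any state, valid under every efficient policy. -/
def maxRate : ℝ := q.arr + ∑ k, (q.M k : ℝ) * q.mu k

/-- Transition probabilities `I + B / Λ` of the uniformized chain, where `B` is the generator and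
`Λ` is the bound on the rates. -/
def unifStep (d : ℕ → Fin K → ℕ) (n m : ℕ) : ℝ :=
  (if n = m then 1 else 0) + q.generator d n m / q.maxRate

/-- Entries of the `j`-th power of the uniformized transition matrix (row `n` of the matrix vanishes
beyond column `n + 1`, so the matrix product is a finite sum). -/
def unifPow (d : ℕ → Fin K → ℕ) : ℕ → ℕ → ℕ → ℝ
  | 0, n, m => if n = m then 1 else 0
  | j + 1, n, m => ∑ l ∈ Finset.range (n + 2), q.unifStep d n l * unifPow d j l m

/-- Transition function `P(n_t = m | n_0 = n)` of the continuous-time Markov chain with generator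
`B`, i.e. the entry of `exp (t B) = ∑ j, e^{-Λ t} (Λ t)^j / j! (I + B / Λ)^j`. -/
def transProb (d : ℕ → Fin K → ℕ) (t : ℝ) (n m : ℕ) : ℝ :=
  ∑' j : ℕ, Real.exp (-(q.maxRate * t)) * (q.maxRate * t) ^ j / (j.factorial : ℝ)
    * q.unifPow d j n m

/-- Expected cost rate at time `t` from the initial state `n`: `E[f(n_t, d(n_t)) | n_0 = n]`. -/
def expCost (d : ℕ → Fin K → ℕ) (t : ℝ) (n : ℕ) : ℝ :=
  ∑' m : ℕ, q.transProb d t n m * q.costRate m (d m)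

/-- The policy `d` has the finite long-run average cost
`η = lim_{T → ∞} E[(1 / T) ∫_0^T f(n_t, d(n_t)) dt]`, from every initial state; the expectations are
required to be finite. -/
def HasAverageCost (d : ℕ → Fin K → ℕ) (η : ℝ) : Prop :=
  ∀ n : ℕ,
    (∀ t : ℝ, 0 ≤ t → Summable fun m : ℕ => q.transProb d t n m * q.costRate m (d m)) ∧
    (∀ T : ℝ, 0 ≤ T →
      IntervalIntegrable (fun t => q.expCost d t n) MeasureTheory.volume 0 T) ∧
    Filter.Tendsto (fun T : ℝ => (1 / T) * ∫ t in (0 : ℝ)..T, q.expCost d t n)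
      Filter.atTop (nhds η)

/-- `d` is an optimal policy, with the finite optimal long-run average cost `η`.  (An efficient
policy without a finite average cost has average cost `+∞` and is no better.) -/
def IsOptimal (d : ℕ → Fin K → ℕ) (η : ℝ) : Prop :=
  q.IsEfficient d ∧ q.HasAverageCost d η ∧
    ∀ (d' : ℕ → Fin K → ℕ) (η' : ℝ), q.IsEfficient d' → q.HasAverageCost d' η' → η ≤ η'

/-- `g` is the performance potential of the policy `d` with average cost `η`:
`g n = E[∫_0^∞ (f(n_t, d(n_t)) - η) dt | n_0 = n]`, the limit as `T → ∞` of the expected integral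
over `[0, T]`. -/
def IsPotential (d : ℕ → Fin K → ℕ) (η : ℝ) (g : ℕ → ℝ) : Prop :=
  ∀ n : ℕ, Filter.Tendsto (fun T : ℝ => ∫ t in (0 : ℝ)..T, (q.expCost d t n - η))
    Filter.atTop (nhds (g n))

/-- `g` is a relative value function of the policy `d` with average cost `η`: a solution of the
Poisson equation `f - η 1 + B g = 0` (row `n` of `B` vanishes beyond column `n + 1`). -/
def SolvesPoisson (d : ℕ → Fin K → ℕ) (η : ℝ) (g : ℕ → ℝ) : Prop :=
  ∀ n : ℕ, q.costRate n (d n) - η + ∑ m ∈ Finset.range (n + 2), q.generator d n m * g m = 0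

/-- The perturbation realization factor `G n = g n - g (n - 1)`; it is meant for `n ≥ 1` only. -/
def prf (g : ℕ → ℝ) (n : ℕ) : ℝ := g n - g (n - 1)

end GroupServerQueue

end

/-! Write `G = prf g` and let `R_a(x) = ∑ a_k (μ_k x - c_k)` be the `reward`. The Poisson equation
is the recursion `λ G(n+1) = η - h(n) + R_{d(n)}(G(n))`, with `G(0) = 0`
(`SolvesPoisson.arr_mul_prf`). Optimality makes `d(n)` maximize `R_a(G(n))` over the admissible
actions (`IsOptimal.reward_le`). Also `G(1) ≥ 0`, because `h(0) ≤ η`.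

Suppose `G` first descends from `n+1` to `n+2`. Moving one server from a larger state to a smaller
one (`IsAction.exchange`), together with convexity of `h`, shows that every later step descends at
least as much, so `G` tends to `-∞`. But with stationary weights `p`, `λ p(n) G(n+1)` is the tail
`∑_{m>n} p(m) (f(m) - η)`, which is nonnegative once the costs exceed `η`. Hence `G` is
nondecreasing from `G(0) = 0` (`IsOptimal.monotone_prf`).

The probabilistic part supplies `p` and turns optimality of time averages into inequalities between
stationary sums. Limits of time averages satisfy detailed balance and lose no cost
(`HasAverageCost.exists_balanced`). Conversely, positive summable weights of finite cost determine
the average cost (`Balanced.hasAverageCost`). Policies that idle with customers present have zero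
weights in low states and need a separate comparison (`IsOptimal.nonneg_of_idle`). -/

open Filter Topology Finset

/-! ### Poisson mixtures of bounded sequences. -/

/-- The mixture of a sequence `a` with the Poisson weights of mean `r * t`. -/
noncomputable def poissonMix (r : ℝ) (a : ℕ → ℝ) (t : ℝ) : ℝ :=
  ∑' j : ℕ, Real.exp (-(r * t)) * (r * t) ^ j / (j.factorial : ℝ) * a j

theorem summable_pow_div_factorial_mul {a : ℕ → ℝ} {C : ℝ} (ha : ∀ j, |a j| ≤ C) (x : ℝ) :
    Summable fun j : ℕ => x ^ j / (j.factorial : ℝ) * a j := by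
  refine Summable.of_norm_bounded (g := fun j : ℕ => |x| ^ j / (j.factorial : ℝ) * C)
    ((Real.summable_pow_div_factorial _).mul_right C) fun j => ?_
  rw [norm_mul, norm_div, norm_pow, Real.norm_eq_abs, Real.norm_eq_abs, Real.norm_eq_abs,
    Nat.abs_cast]
  exact mul_le_mul_of_nonneg_left (ha j) (by positivity)

/-- Termwise differentiation on a ball containing `x`, with derivatives dominated by `u`. The term
`j = 0` drops out and `j / j! = 1 / (j - 1)!` shifts the index. -/
theorem hasDerivAt_tsum_pow_div_factorial_mul {a : ℕ → ℝ} {C : ℝ} (ha : ∀ j, |a j| ≤ C) (x : ℝ) :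
    HasDerivAt (fun x => ∑' j : ℕ, x ^ j / (j.factorial : ℝ) * a j)
      (∑' j : ℕ, x ^ j / (j.factorial : ℝ) * a (j + 1)) x := by
  have hC : 0 ≤ C := (abs_nonneg _).trans (ha 0)
  set R := |x| + 1 with hR
  have hR0 : 0 < R := by positivity
  let u : ℕ → ℝ := fun j => j * R ^ (j - 1) / (j.factorial : ℝ) * C
  have hfac : ∀ (y : ℝ) (j : ℕ), ((j + 1 : ℕ) : ℝ) * y ^ (j + 1 - 1) / ((j + 1).factorial : ℝ)
      = y ^ j / (j.factorial : ℝ) := by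
    intro y j
    rw [Nat.factorial_succ, Nat.add_sub_cancel, Nat.cast_mul,
      mul_div_mul_left _ _ (Nat.cast_ne_zero.2 (Nat.succ_ne_zero j))]
  have hu : Summable u := by
    rw [← summable_nat_add_iff 1]
    simp only [u, hfac]
    exact (Real.summable_pow_div_factorial _).mul_right C
  have key := hasDerivAt_tsum_of_isPreconnected (𝕜 := ℝ)
    (g := fun (j : ℕ) (x : ℝ) => x ^ j / (j.factorial : ℝ) * a j)
    (g' := fun (j : ℕ) (x : ℝ) => j * x ^ (j - 1) / (j.factorial : ℝ) * a j)
    (t := Metric.ball 0 R) (y₀ := 0) (y := x) hu Metric.isOpen_ball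
    (convex_ball (0 : ℝ) R).isPreconnected
    (fun j y _ => ((hasDerivAt_pow j y).div_const _).mul_const _)
    (fun j y hy => by
      have hy' : |y| ≤ R := by simpa using (mem_ball_zero_iff.1 hy).le
      rw [norm_mul, norm_div, norm_mul, norm_pow, Real.norm_eq_abs, Real.norm_eq_abs,
        Real.norm_eq_abs, Real.norm_eq_abs, Nat.abs_cast, Nat.abs_cast]
      have := ha j
      simp only [u]
      gcongr)
    (Metric.mem_ball_self hR0) (summable_pow_div_factorial_mul ha 0)
    (by simp [hR])
  refine key.congr_deriv ?_
  have hs : Summable fun j : ℕ => (j : ℝ) * x ^ (j - 1) / (j.factorial : ℝ) * a j := by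
    rw [← summable_nat_add_iff 1]
    simp only [hfac]
    exact summable_pow_div_factorial_mul (fun j => ha (j + 1)) x
  rw [hs.tsum_eq_zero_add]
  simp only [hfac]
  simp

theorem poissonMix_eq (r : ℝ) (a : ℕ → ℝ) (t : ℝ) :
    poissonMix r a t
      = Real.exp (-(r * t)) * ∑' j : ℕ, (r * t) ^ j / (j.factorial : ℝ) * a j := by
  rw [poissonMix, ← tsum_mul_left]
  exact tsum_congr fun j => by ring

theorem summable_poissonMix (r : ℝ) {a : ℕ → ℝ} {C : ℝ} (ha : ∀ j, |a j| ≤ C) (t : ℝ) :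
    Summable fun j : ℕ => Real.exp (-(r * t)) * (r * t) ^ j / (j.factorial : ℝ) * a j := by
  refine ((summable_pow_div_factorial_mul ha (r * t)).mul_left (Real.exp (-(r * t)))).congr
    fun j => ?_
  ring

/-- The Poisson weights satisfy `w_j' = r (w_{j-1} - w_j)`. For powers of the uniformized matrix
this shift becomes the Kolmogorov equations. -/
theorem hasDerivAt_poissonMix (r : ℝ) {a : ℕ → ℝ} {C : ℝ} (ha : ∀ j, |a j| ≤ C) (t : ℝ) :
    HasDerivAt (poissonMix r a)
      (r * (poissonMix r (fun j => a (j + 1)) t - poissonMix r a t)) t := by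
  have h0 : HasDerivAt (fun t : ℝ => r * t) r t := by
    simpa using (hasDerivAt_id t).const_mul r
  have h1 := h0.fun_neg.exp
  have h2 := (hasDerivAt_tsum_pow_div_factorial_mul ha (r * t)).comp t h0
  have h3 := h1.mul h2
  rw [show poissonMix r a = fun t => Real.exp (-(r * t)) *
    ∑' j : ℕ, (r * t) ^ j / (j.factorial : ℝ) * a j from funext (poissonMix_eq r a)]
  refine h3.congr_deriv ?_
  rw [poissonMix_eq]
  simp only [Function.comp]
  ring

theorem continuous_poissonMix (r : ℝ) {a : ℕ → ℝ} {C : ℝ} (ha : ∀ j, |a j| ≤ C) :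
    Continuous (poissonMix r a) :=
  continuous_iff_continuousAt.2 fun t => (hasDerivAt_poissonMix r ha t).continuousAt

theorem poissonMix_const (r c t : ℝ) : poissonMix r (fun _ => c) t = c := by
  rw [poissonMix_eq, tsum_mul_right]
  have : ∑' j : ℕ, (r * t) ^ j / (j.factorial : ℝ) = Real.exp (r * t) := by
    rw [Real.exp_eq_exp_ℝ, NormedSpace.exp_eq_tsum_div]
  rw [this, ← mul_assoc, ← Real.exp_add]
  simp

theorem poissonMix_zero_right (r : ℝ) (a : ℕ → ℝ) : poissonMix r a 0 = a 0 := by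
  rw [poissonMix, tsum_eq_single 0 (fun j hj => by simp [hj])]
  simp

theorem poissonMix_mono {r t : ℝ} (hrt : 0 ≤ r * t) {a b : ℕ → ℝ} {C D : ℝ}
    (ha : ∀ j, |a j| ≤ C) (hb : ∀ j, |b j| ≤ D) (h : ∀ j, a j ≤ b j) :
    poissonMix r a t ≤ poissonMix r b t :=
  (summable_poissonMix r ha t).tsum_le_tsum
    (fun j => mul_le_mul_of_nonneg_left (h j) (by positivity)) (summable_poissonMix r hb t)

theorem poissonMix_const_mul (r c : ℝ) (a : ℕ → ℝ) (t : ℝ) :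
    poissonMix r (fun j => c * a j) t = c * poissonMix r a t := by
  rw [poissonMix, poissonMix, ← tsum_mul_left]
  exact tsum_congr fun j => by ring

theorem poissonMix_sum {ι : Type*} (s : Finset ι) (r : ℝ) {a : ι → ℕ → ℝ} {C : ι → ℝ}
    (ha : ∀ i j, |a i j| ≤ C i) (t : ℝ) :
    poissonMix r (fun j => ∑ i ∈ s, a i j) t = ∑ i ∈ s, poissonMix r (a i) t := by
  simp only [poissonMix, Finset.mul_sum]
  exact Summable.tsum_finsetSum fun i _ => summable_poissonMix r (ha i) t

/-- Mixing commutes with summation of nonnegative sequences of total mass one. -/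
theorem hasSum_poissonMix_one {r t : ℝ} (hrt : 0 ≤ r * t) {a : ℕ → ℕ → ℝ}
    (h0 : ∀ j m, 0 ≤ a j m) (h1 : ∀ j, HasSum (a j) 1) :
    HasSum (fun m => poissonMix r (fun j => a j m) t) 1 := by
  let w : ℕ → ℝ := fun j => Real.exp (-(r * t)) * (r * t) ^ j / (j.factorial : ℝ)
  have hw : ∀ j, 0 ≤ w j := fun j =>
    div_nonneg (mul_nonneg (Real.exp_nonneg _) (pow_nonneg hrt j)) (Nat.cast_nonneg _)
  have hs : Summable w :=
    (summable_poissonMix r (a := fun _ => 1) (C := 1) (by simp) t).congr fun j => mul_one _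
  have hF : Summable (fun x : ℕ × ℕ => w x.1 * a x.1 x.2) := by
    rw [summable_prod_of_nonneg (fun x => mul_nonneg (hw _) (h0 _ _))]
    refine ⟨fun j => (h1 j).summable.mul_left (w j), ?_⟩
    refine hs.congr fun j => ?_
    exact (mul_one (w j)).symm.trans (by rw [← (h1 j).tsum_eq, ← tsum_mul_left])
  have hsum : Summable fun m => poissonMix r (fun j => a j m) t := (hF.prod_symm.prod :)
  have : ∑' m, poissonMix r (fun j => a j m) t = 1 := by
    have hc := hF.tsum_comm (f := fun j m => w j * a j m)
    have h2 : ∑' m, poissonMix r (fun j => a j m) t = ∑' m, ∑' j, w j * a j m := rfl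
    rw [h2, hc]
    rw [← poissonMix_const r 1 t]
    refine tsum_congr fun j => ?_
    rw [tsum_mul_left, (h1 j).tsum_eq]
  exact this ▸ hsum.hasSum

/-! ### The uniformized chain and detailed balance. -/

namespace GroupServerQueue

variable {K : ℕ} {q : GroupServerQueue K} {d : ℕ → Fin K → ℕ}

theorem serviceRate_nonneg (q : GroupServerQueue K) (a : Fin K → ℕ) : 0 ≤ q.serviceRate a :=
  Finset.sum_nonneg fun k _ => mul_nonneg (Nat.cast_nonneg _) (q.mu_pos k).le

theorem maxRate_pos (q : GroupServerQueue K) : 0 < q.maxRate :=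
  add_pos_of_pos_of_nonneg q.arr_pos (q.serviceRate_nonneg q.M)

theorem IsEfficient.serviceRate_le (hd : q.IsEfficient d) (n : ℕ) :
    q.serviceRate (d n) ≤ q.serviceRate q.M :=
  Finset.sum_le_sum fun k _ =>
    mul_le_mul_of_nonneg_right (Nat.cast_le.2 ((hd n).1 k)) (q.mu_pos k).le

theorem IsEfficient.apply_zero (hd : q.IsEfficient d) : d 0 = 0 := by
  funext k
  exact (Finset.sum_eq_zero_iff.1 (Nat.le_zero.1 (hd 0).2)) k (Finset.mem_univ k)

theorem serviceRate_zero (q : GroupServerQueue K) : q.serviceRate 0 = 0 := by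
  simp [serviceRate]

theorem IsEfficient.serviceRate_apply_zero (hd : q.IsEfficient d) : q.serviceRate (d 0) = 0 := by
  rw [hd.apply_zero, serviceRate_zero]

/-- Rows of the generator, applied to a function. -/
theorem IsEfficient.sum_generator_mul (hd : q.IsEfficient d) (u : ℕ → ℝ) (n : ℕ) :
    ∑ m ∈ range (n + 2), q.generator d n m * u m
      = q.arr * (u (n + 1) - u n) - q.serviceRate (d n) * (u n - u (n - 1)) := by
  rw [Finset.sum_range_succ, Finset.sum_range_succ]
  cases n with
  | zero => simp [generator, hd.serviceRate_apply_zero]; ring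
  | succ n =>
    rw [Finset.sum_range_succ, Finset.sum_eq_zero]
    · have h : ¬ n = n + 1 + 1 := by omega
      simp [generator, h]
      ring
    · intro m hm
      have := Finset.mem_range.1 hm
      rw [generator, if_neg (by omega), if_neg (by omega), if_neg (by omega), zero_mul]

theorem sum_unifStep_mul (q : GroupServerQueue K) (d : ℕ → Fin K → ℕ) (u : ℕ → ℝ) (n : ℕ) :
    ∑ m ∈ range (n + 2), q.unifStep d n m * u m
      = u n + (∑ m ∈ range (n + 2), q.generator d n m * u m) / q.maxRate := by
  simp only [unifStep, add_mul, Finset.sum_add_distrib, ite_mul, one_mul, zero_mul,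
    Finset.sum_div]
  congr 1
  · simp
  · exact Finset.sum_congr rfl fun m _ => by ring

theorem unifStep_eq_zero {n m : ℕ} (h : n + 1 < m ∨ m + 1 < n) : q.unifStep d n m = 0 := by
  have h1 : n ≠ m := by omega
  have h2 : m ≠ n + 1 := by omega
  have h3 : m + 1 ≠ n := by omega
  simp [unifStep, generator, h1, h1.symm, h2, h3]

/-- Columns of the uniformized transition matrix up to column `m`, applied to weights. -/
theorem IsEfficient.sum_mul_unifStep (hd : q.IsEfficient d) (v : ℕ → ℝ) (m : ℕ) :
    ∑ i ∈ range (m + 1), ∑ l ∈ range (i + 2), v l * q.unifStep d l i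
      = ∑ i ∈ range (m + 1), v i
        + (q.serviceRate (d (m + 1)) * v (m + 1) - q.arr * v m) / q.maxRate := by
  induction m with
  | zero =>
    simp [Finset.sum_range_succ, unifStep, generator, hd.serviceRate_apply_zero]
    ring
  | succ m ih =>
    have hcol : ∑ l ∈ range (m + 1 + 2), v l * q.unifStep d l (m + 1)
        = v m * (q.arr / q.maxRate)
          + v (m + 1) * (1 - (q.arr + q.serviceRate (d (m + 1))) / q.maxRate)
          + v (m + 2) * (q.serviceRate (d (m + 2)) / q.maxRate) := by
      rw [Finset.sum_range_succ, Finset.sum_range_succ, Finset.sum_range_succ, Finset.sum_eq_zero]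
      · simp [unifStep, generator]
        left
        ring
      · intro l hl
        have := Finset.mem_range.1 hl
        rw [unifStep_eq_zero (by omega), mul_zero]
    rw [Finset.sum_range_succ, ih, Finset.sum_range_succ _ (m + 1), hcol]
    ring

theorem IsEfficient.unifStep_nonneg (hd : q.IsEfficient d) (n m : ℕ) : 0 ≤ q.unifStep d n m := by
  have hΛ := q.maxRate_pos
  have h1 := q.arr_pos
  have h2 := q.serviceRate_nonneg (d n)
  rw [unifStep, generator]
  split_ifs with h3 h4 h5 h6 h7 h8
  · positivity
  · positivity
  · have : (q.arr + q.serviceRate (d n)) / q.maxRate ≤ 1 :=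
      (div_le_one hΛ).2 (by
        have := hd.serviceRate_le n
        simp only [maxRate, serviceRate] at *
        linarith)
    rw [neg_div]
    linarith
  · simp
  · positivity
  · positivity
  · omega
  · simp

theorem IsEfficient.unifPow_nonneg (hd : q.IsEfficient d) (j n m : ℕ) :
    0 ≤ q.unifPow d j n m := by
  induction j generalizing n with
  | zero => rw [unifPow]; split_ifs <;> norm_num
  | succ j ih =>
    exact Finset.sum_nonneg fun l _ => mul_nonneg (hd.unifStep_nonneg n l) (ih l)

theorem IsEfficient.hasSum_unifPow (hd : q.IsEfficient d) (j n : ℕ) :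
    HasSum (fun m => q.unifPow d j n m) 1 := by
  induction j generalizing n with
  | zero => simpa [unifPow, eq_comm] using hasSum_ite_eq n (1 : ℝ)
  | succ j ih =>
    have h := hasSum_sum (s := range (n + 2))
      fun l _ => (ih l).mul_left (q.unifStep d n l)
    have h1 := q.sum_unifStep_mul d (fun _ => 1) n
    rw [hd.sum_generator_mul] at h1
    rw [h1] at h
    simpa [unifPow] using h

theorem IsEfficient.unifPow_le_one (hd : q.IsEfficient d) (j n m : ℕ) :
    q.unifPow d j n m ≤ 1 :=
  le_hasSum (hd.hasSum_unifPow j n) m fun i _ => hd.unifPow_nonneg j n i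

theorem IsEfficient.abs_unifPow_le (hd : q.IsEfficient d) (j n m : ℕ) :
    |q.unifPow d j n m| ≤ 1 :=
  abs_le.2 ⟨by linarith [hd.unifPow_nonneg j n m], hd.unifPow_le_one j n m⟩

/-- The powers of the uniformized matrix also satisfy the recursion by columns. -/
theorem unifPow_succ' (j n m : ℕ) :
    q.unifPow d (j + 1) n m = ∑ l ∈ range (m + 2), q.unifPow d j n l * q.unifStep d l m := by
  induction j generalizing n with
  | zero =>
    simp only [unifPow, mul_ite, mul_one, mul_zero, ite_mul, one_mul, zero_mul,
      Finset.sum_ite_eq, Finset.sum_ite_eq', Finset.mem_range]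
    split_ifs with h1 h2 h2
    · rfl
    · exact unifStep_eq_zero (by omega)
    · exact (unifStep_eq_zero (by omega)).symm
    · rfl
  | succ j ih =>
    rw [unifPow]
    simp only [ih, Finset.mul_sum]
    rw [Finset.sum_comm]
    refine Finset.sum_congr rfl fun k _ => ?_
    rw [unifPow, Finset.sum_mul]
    exact Finset.sum_congr rfl fun l _ => by ring

/-- Weights `p` are stationary (in detailed balance) under the policy `d`. -/
def Balanced (q : GroupServerQueue K) (d : ℕ → Fin K → ℕ) (p : ℕ → ℝ) : Prop :=
  ∀ m, q.arr * p m = q.serviceRate (d (m + 1)) * p (m + 1)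

/-- Subtract the identities for the columns up to `m` and up to `m - 1`: detailed balance cancels
the net flow across each cut. -/
theorem Balanced.sum_mul_unifStep {p : ℕ → ℝ} (hp : q.Balanced d p) (hd : q.IsEfficient d)
    (m : ℕ) : ∑ l ∈ range (m + 2), p l * q.unifStep d l m = p m := by
  have h1 := hd.sum_mul_unifStep p m
  rw [Finset.sum_range_succ, Finset.sum_range_succ _ m] at h1
  rw [← hp m] at h1
  cases m with
  | zero => simpa using h1
  | succ m =>
    rw [hd.sum_mul_unifStep p m, ← hp m] at h1
    simp only [sub_self, zero_div, add_zero] at h1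
    linarith

/-- The left side is one term of the stationary sum for `p m`. The resulting bound `p m / p n` does
not depend on time and is the dominating sequence in all later interchanges of limits. -/
theorem Balanced.mul_unifPow_le {p : ℕ → ℝ} (hp : q.Balanced d p) (hd : q.IsEfficient d)
    (hp0 : ∀ m, 0 ≤ p m) (j n m : ℕ) : p n * q.unifPow d j n m ≤ p m := by
  induction j generalizing m with
  | zero =>
    rw [unifPow]
    split_ifs with h
    · rw [h, mul_one]
    · rw [mul_zero]; exact hp0 m
  | succ j ih =>
    rw [unifPow_succ', Finset.mul_sum, ← hp.sum_mul_unifStep hd m]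
    refine Finset.sum_le_sum fun l _ => ?_
    rw [← mul_assoc]
    exact mul_le_mul_of_nonneg_right (ih l) (hd.unifStep_nonneg l m)

/-! ### The transition function and Kolmogorov's equations. -/

theorem transProb_eq_poissonMix (t : ℝ) (n m : ℕ) :
    q.transProb d t n m = poissonMix q.maxRate (fun j => q.unifPow d j n m) t := rfl

theorem IsEfficient.continuous_transProb (hd : q.IsEfficient d) (n m : ℕ) :
    Continuous fun t => q.transProb d t n m :=
  continuous_poissonMix _ fun j => hd.abs_unifPow_le j n m

theorem transProb_zero (n m : ℕ) :
    q.transProb d 0 n m = if n = m then 1 else 0 := by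
  rw [transProb_eq_poissonMix, poissonMix_zero_right, unifPow]

theorem IsEfficient.hasSum_transProb (hd : q.IsEfficient d) {t : ℝ} (ht : 0 ≤ t) (n : ℕ) :
    HasSum (fun m => q.transProb d t n m) 1 :=
  hasSum_poissonMix_one (mul_nonneg q.maxRate_pos.le ht)
    (fun j m => hd.unifPow_nonneg j n m) fun j => hd.hasSum_unifPow j n

theorem IsEfficient.transProb_nonneg (hd : q.IsEfficient d) {t : ℝ} (ht : 0 ≤ t) (n m : ℕ) :
    0 ≤ q.transProb d t n m := by
  rw [← poissonMix_const q.maxRate 0 t]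
  exact poissonMix_mono (mul_nonneg q.maxRate_pos.le ht) (C := 0) (by simp)
    (fun j => hd.abs_unifPow_le j n m) fun j => hd.unifPow_nonneg j n m

theorem Balanced.mul_transProb_le {p : ℕ → ℝ} (hp : q.Balanced d p) (hd : q.IsEfficient d)
    (hp0 : ∀ m, 0 ≤ p m) {t : ℝ} (ht : 0 ≤ t) (n m : ℕ) :
    p n * q.transProb d t n m ≤ p m := by
  rw [transProb_eq_poissonMix, ← poissonMix_const_mul, ← poissonMix_const q.maxRate (p m) t]
  refine poissonMix_mono (mul_nonneg q.maxRate_pos.le ht) (C := p n) (D := |p m|) (fun j => ?_)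
    (fun j => le_rfl) fun j => hp.mul_unifPow_le hd hp0 j n m
  rw [abs_mul, abs_of_nonneg (hp0 n)]
  exact mul_le_of_le_one_right (hp0 n) (hd.abs_unifPow_le j n m)

/-- Kolmogorov's backward equation. -/
theorem IsEfficient.hasDerivAt_transProb (hd : q.IsEfficient d) (t : ℝ) (n m : ℕ) :
    HasDerivAt (fun t => q.transProb d t n m)
      (∑ l ∈ range (n + 2), q.generator d n l * q.transProb d t l m) t := by
  refine (hasDerivAt_poissonMix q.maxRate (fun j => hd.abs_unifPow_le j n m) t).congr_deriv ?_
  have h : poissonMix q.maxRate (fun j => q.unifPow d (j + 1) n m) t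
      = ∑ l ∈ range (n + 2), q.unifStep d n l * q.transProb d t l m := by
    simp only [unifPow]
    rw [poissonMix_sum (a := fun l j => q.unifStep d n l * q.unifPow d j l m)
      (C := fun l => |q.unifStep d n l|)]
    · exact Finset.sum_congr rfl fun l _ => poissonMix_const_mul _ _ _ _
    · intro l j
      rw [abs_mul]
      exact mul_le_of_le_one_right (abs_nonneg _) (hd.abs_unifPow_le j l m)
  have hΛ := q.maxRate_pos.ne'
  rw [h, sum_unifStep_mul, ← transProb_eq_poissonMix]
  field_simp
  ring

/-- Kolmogorov's forward equation for the probability of the states up to `m`. -/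
theorem IsEfficient.hasDerivAt_sum_transProb (hd : q.IsEfficient d) (t : ℝ) (n m : ℕ) :
    HasDerivAt (fun t => ∑ i ∈ range (m + 1), q.transProb d t n i)
      (q.serviceRate (d (m + 1)) * q.transProb d t n (m + 1) - q.arr * q.transProb d t n m) t := by
  have h1 : ∀ i, HasDerivAt (fun t => q.transProb d t n i)
      (q.maxRate * (∑ l ∈ range (i + 2), q.transProb d t n l * q.unifStep d l i
        - q.transProb d t n i)) t := by
    intro i
    refine (hasDerivAt_poissonMix q.maxRate (fun j => hd.abs_unifPow_le j n i) t).congr_deriv ?_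
    simp only [unifPow_succ']
    rw [poissonMix_sum (a := fun l j => q.unifPow d j n l * q.unifStep d l i)
      (C := fun l => |q.unifStep d l i|), ← transProb_eq_poissonMix]
    · congr 2
      refine Finset.sum_congr rfl fun l _ => ?_
      rw [mul_comm, transProb_eq_poissonMix, ← poissonMix_const_mul]
      simp only [mul_comm]
    · intro l j
      rw [abs_mul]
      exact mul_le_of_le_one_left (abs_nonneg _) (hd.abs_unifPow_le j n l)
  have h2 := HasDerivAt.fun_sum (u := range (m + 1)) fun i _ => h1 i
  refine h2.congr_deriv ?_
  rw [← Finset.mul_sum, Finset.sum_sub_distrib, hd.sum_mul_unifStep]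
  have hΛ := q.maxRate_pos.ne'
  field_simp
  ring

/-! ### Time averages and their limit points. -/

/-- Expected fraction of the time up to `T` that the chain from `n` spends in the state `m`. -/
noncomputable def avgProb (q : GroupServerQueue K) (d : ℕ → Fin K → ℕ) (T : ℝ) (n m : ℕ) : ℝ :=
  (1 / T) * ∫ t in (0 : ℝ)..T, q.transProb d t n m

theorem IsEfficient.intervalIntegrable_transProb (hd : q.IsEfficient d) (n m : ℕ) (a b : ℝ) :
    IntervalIntegrable (fun t => q.transProb d t n m) MeasureTheory.volume a b :=
  (hd.continuous_transProb n m).intervalIntegrable a b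

theorem IsEfficient.avgProb_nonneg (hd : q.IsEfficient d) {T : ℝ} (hT : 0 ≤ T) (n m : ℕ) :
    0 ≤ q.avgProb d T n m :=
  mul_nonneg (by positivity)
    (intervalIntegral.integral_nonneg hT fun t ht => hd.transProb_nonneg ht.1 n m)

/-- Only finitely many states are integrated, so no domination is needed before stationary weights
are known. -/
theorem IsEfficient.sum_avgProb_mul_le (hd : q.IsEfficient d) {T : ℝ} (hT : 0 < T) (n N : ℕ)
    (u : ℕ → ℝ) {e : ℝ → ℝ} (he : IntervalIntegrable e MeasureTheory.volume 0 T)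
    (h : ∀ t, 0 ≤ t → ∑ m ∈ range N, q.transProb d t n m * u m ≤ e t) :
    ∑ m ∈ range N, q.avgProb d T n m * u m ≤ (1 / T) * ∫ t in (0 : ℝ)..T, e t := by
  have hi : ∀ m, IntervalIntegrable (fun t => q.transProb d t n m * u m)
      MeasureTheory.volume 0 T := fun m => (hd.intervalIntegrable_transProb n m 0 T).mul_const _
  have h1 : ∑ m ∈ range N, q.avgProb d T n m * u m
      = (1 / T) * ∫ t in (0 : ℝ)..T, ∑ m ∈ range N, q.transProb d t n m * u m := by
    rw [intervalIntegral.integral_finsetSum fun m _ => hi m, Finset.mul_sum]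
    refine Finset.sum_congr rfl fun m _ => ?_
    rw [intervalIntegral.integral_mul_const, avgProb, mul_assoc]
  rw [h1]
  refine mul_le_mul_of_nonneg_left ?_ (by positivity)
  refine intervalIntegral.integral_mono_on hT.le ?_ he fun t ht => h t ht.1
  exact (continuous_finsetSum _ fun m _ =>
    (hd.continuous_transProb n m).mul continuous_const).intervalIntegrable 0 T

theorem IsEfficient.sum_avgProb_le_one (hd : q.IsEfficient d) {T : ℝ} (hT : 0 < T) (n N : ℕ) :
    ∑ m ∈ range N, q.avgProb d T n m ≤ 1 := by
  have h := hd.sum_avgProb_mul_le hT n N (fun _ => 1) (e := fun _ => 1) (by simp)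
    (fun t ht => by
      simpa using sum_le_hasSum (range N) (fun m _ => hd.transProb_nonneg ht n m)
        (hd.hasSum_transProb ht n))
  have hT' := hT.ne'
  simpa [hT'] using h

/-- By the forward equation, `T` times the imbalance is the change over `[0, T]` of the probability
of the states up to `m`, which stays in `[0, 1]`. -/
theorem IsEfficient.abs_avgProb_balance_le (hd : q.IsEfficient d) {T : ℝ} (hT : 0 < T)
    (n m : ℕ) :
    |q.serviceRate (d (m + 1)) * q.avgProb d T n (m + 1) - q.arr * q.avgProb d T n m|
      ≤ 1 / T := by
  have hi := fun i => hd.intervalIntegrable_transProb n i 0 T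
  have h1 := intervalIntegral.integral_eq_sub_of_hasDerivAt
    (fun t _ => hd.hasDerivAt_sum_transProb t n m)
    (((hi (m + 1)).const_mul _).sub ((hi m).const_mul _))
  rw [intervalIntegral.integral_sub ((hi (m + 1)).const_mul _) ((hi m).const_mul _),
    intervalIntegral.integral_const_mul, intervalIntegral.integral_const_mul] at h1
  have h2 : ∀ t, 0 ≤ t → ∑ i ∈ range (m + 1), q.transProb d t n i ∈ Set.Icc (0 : ℝ) 1 :=
    fun t ht => ⟨Finset.sum_nonneg fun i _ => hd.transProb_nonneg ht n i,
      sum_le_hasSum _ (fun i _ => hd.transProb_nonneg ht n i) (hd.hasSum_transProb ht n)⟩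
  have h3 := h2 T hT.le
  have h4 := h2 0 le_rfl
  have h5 : q.serviceRate (d (m + 1)) * q.avgProb d T n (m + 1) - q.arr * q.avgProb d T n m
      = (1 / T) * (∑ i ∈ range (m + 1), q.transProb d T n i
        - ∑ i ∈ range (m + 1), q.transProb d 0 n i) := by
    rw [← h1, avgProb, avgProb]
    ring
  rw [h5, abs_mul, abs_of_pos (by positivity : 0 < 1 / T)]
  refine mul_le_of_le_one_right (by positivity) (abs_le.2 ⟨?_, ?_⟩)
  · linarith [h3.1, h4.2]
  · linarith [h3.2, h4.1]

/-- Limit points of the time averages exist, and they are stationary. -/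
theorem IsEfficient.exists_limit_avgProb (hd : q.IsEfficient d) (n : ℕ) (U : Ultrafilter ℝ)
    (hU : (U : Filter ℝ) ≤ atTop) :
    ∃ p : ℕ → ℝ, (∀ m, Tendsto (fun T => q.avgProb d T n m) U (𝓝 (p m))) ∧ (∀ m, 0 ≤ p m) ∧
      q.Balanced d p := by
  have hpos : ∀ᶠ T in (U : Filter ℝ), 0 < T := hU (eventually_gt_atTop 0)
  have h1 : ∀ m, ∃ x ∈ Set.Icc (0 : ℝ) 1, Tendsto (fun T => q.avgProb d T n m) U (𝓝 x) := by
    intro m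
    refine isCompact_Icc.ultrafilter_le_nhds' (U.map fun T => q.avgProb d T n m) ?_
    refine hpos.mono fun T hT => ?_
    exact ⟨hd.avgProb_nonneg hT.le n m, (Finset.single_le_sum
      (f := fun m => q.avgProb d T n m) (fun i _ => hd.avgProb_nonneg hT.le n i)
      (Finset.mem_range.2 (Nat.lt_succ_self m))).trans (hd.sum_avgProb_le_one hT n (m + 1))⟩
  choose p hp hlim using h1
  refine ⟨p, hlim, fun m => (hp m).1, fun m => ?_⟩
  have h2 := (((hlim (m + 1)).const_mul (q.serviceRate (d (m + 1)))).sub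
    ((hlim m).const_mul q.arr)).abs
  have h3 : Tendsto (fun T : ℝ => 1 / T) U (𝓝 0) := by
    simpa using (tendsto_inv_atTop_zero (𝕜 := ℝ)).mono_left hU
  have h4 := le_of_tendsto_of_tendsto h2 h3 (by
    filter_upwards [hpos] with T hT using hd.abs_avgProb_balance_le hT n m)
  have h5 := abs_nonpos_iff.1 h4
  linarith

theorem le_costRate (q : GroupServerQueue K) (n : ℕ) (a : Fin K → ℕ) :
    q.h n ≤ q.costRate n a :=
  le_add_of_nonneg_right
    (Finset.sum_nonneg fun k _ => mul_nonneg (Nat.cast_nonneg _) (q.c_nonneg k))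

theorem exists_le_costRate (q : GroupServerQueue K) (x : ℝ) :
    ∃ N, ∀ m, N ≤ m → ∀ a : Fin K → ℕ, x ≤ q.costRate m a := by
  obtain ⟨N, hN⟩ := (q.h_tendsto.eventually_ge_atTop x).exists_forall_of_atTop
  exact ⟨N, fun m hm a => (hN m hm).trans (q.le_costRate m a)⟩

/-- A policy with a finite average cost has stationary weights of at most this cost. -/
theorem HasAverageCost.exists_balanced {η : ℝ} (h : q.HasAverageCost d η)
    (hd : q.IsEfficient d) :
    ∃ p : ℕ → ℝ, q.Balanced d p ∧ (∀ m, 0 ≤ p m) ∧ (∃ m, 0 < p m) ∧ Summable p ∧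
      ∃ S ≤ 0, HasSum (fun m => p m * (q.costRate m (d m) - η)) S := by
  -- Along an ultrafilter the limits in all states exist at once, without extracting subsequences.
  let U : Ultrafilter ℝ := Ultrafilter.of atTop
  have hU : (U : Filter ℝ) ≤ atTop := Ultrafilter.of_le _
  have hpos : ∀ᶠ T in (U : Filter ℝ), 0 < T := hU (eventually_gt_atTop 0)
  obtain ⟨p, hlim, hp0, hbal⟩ := hd.exists_limit_avgProb 0 U hU
  obtain ⟨hsum, hint, hη⟩ := h 0
  -- Beyond `N` the excess of the cost over `x` is nonnegative, so truncating at `N` can only lower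
  -- the mean excess; the inequality survives the limit.
  have key : ∀ x N, (∀ m, N ≤ m → x ≤ q.costRate m (d m)) →
      ∑ m ∈ range N, p m * (q.costRate m (d m) - x) ≤ η - x := by
    intro x N hN
    have h1 : Tendsto (fun T => ∑ m ∈ range N, q.avgProb d T 0 m * (q.costRate m (d m) - x)) U
        (𝓝 (∑ m ∈ range N, p m * (q.costRate m (d m) - x))) :=
      tendsto_finsetSum _ fun m _ => (hlim m).mul_const _
    have h2 := (hη.mono_left hU).sub_const x
    refine le_of_tendsto_of_tendsto h1 h2 ?_
    filter_upwards [hpos] with T hT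
    have h3 := hd.sum_avgProb_mul_le hT 0 N (fun m => q.costRate m (d m) - x)
      (e := fun t => q.expCost d t 0 - x) ((hint T hT.le).sub (by simp)) (fun t ht => by
        have h4 := (hsum t ht).hasSum.sub ((hd.hasSum_transProb ht 0).mul_right x)
        rw [one_mul] at h4
        simp only [← mul_sub] at h4
        refine sum_le_hasSum _ (fun m hm => ?_) h4
        exact mul_nonneg (hd.transProb_nonneg ht 0 m)
          (sub_nonneg.2 (hN m (by simpa using hm))))
    rw [intervalIntegral.integral_sub (hint T hT.le) (by simp)] at h3
    have hT' := hT.ne'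
    refine h3.trans (le_of_eq ?_)
    simp only [intervalIntegral.integral_const, smul_eq_mul, sub_zero]
    field_simp
  have hps : Summable p := by
    refine summable_of_sum_range_le hp0 (c := 1) fun N => ?_
    have h1 : Tendsto (fun T => ∑ m ∈ range N, q.avgProb d T 0 m) U
        (𝓝 (∑ m ∈ range N, p m)) := tendsto_finsetSum _ fun m _ => hlim m
    refine le_of_tendsto h1 ?_
    filter_upwards [hpos] with T hT using hd.sum_avgProb_le_one hT 0 N
  refine ⟨p, hbal, hp0, ?_, hps, ?_⟩
  · by_contra! hneg
    have hz : ∀ m, p m = 0 := fun m => le_antisymm (hneg m) (hp0 m)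
    -- Mass cannot all escape to infinity: at level `η + 1`, zero weights would give `0 ≤ -1`.
    obtain ⟨N, hN⟩ := q.exists_le_costRate (η + 1)
    have := key (η + 1) N fun m hm => hN m hm _
    simp only [hz, zero_mul, Finset.sum_const_zero] at this
    linarith
  · obtain ⟨N, hN⟩ := q.exists_le_costRate η
    have hle : ∀ M, N ≤ M → ∑ m ∈ range M, p m * (q.costRate m (d m) - η) ≤ 0 := fun M hM => by
      simpa using key η M fun m hm => hN m (hM.trans hm) _
    have hs : Summable fun m => p m * (q.costRate m (d m) - η) := by
      rw [← summable_nat_add_iff N]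
      refine summable_of_sum_range_le
        (c := - ∑ m ∈ range N, p m * (q.costRate m (d m) - η))
        (fun m => mul_nonneg (hp0 _) (sub_nonneg.2 (hN _ (Nat.le_add_left N m) _)))
        fun M => ?_
      have h1 := hle (N + M) (Nat.le_add_right N M)
      rw [Finset.sum_range_add] at h1
      simp only [add_comm N] at h1
      linarith
    refine ⟨_, ?_, hs.hasSum⟩
    exact le_of_tendsto hs.hasSum.tendsto_sum_nat
      (eventually_atTop.2 ⟨N, hle⟩)

/-! ### Ergodic averages and potentials under positive stationary weights. -/

section Positive

variable {p : ℕ → ℝ}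

theorem Balanced.transProb_le (hp : q.Balanced d p) (hd : q.IsEfficient d)
    (hpos : ∀ m, 0 < p m) {t : ℝ} (ht : 0 ≤ t) (n m : ℕ) :
    q.transProb d t n m ≤ p m / p n :=
  (le_div_iff₀' (hpos n)).2 (hp.mul_transProb_le hd (fun m => (hpos m).le) ht n m)

theorem Balanced.norm_transProb_mul_le (hp : q.Balanced d p) (hd : q.IsEfficient d)
    (hpos : ∀ m, 0 < p m) {t : ℝ} (ht : 0 ≤ t) (n m : ℕ) (x : ℝ) :
    ‖q.transProb d t n m * x‖ ≤ |p m * x| / p n := by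
  rw [Real.norm_eq_abs, abs_mul, abs_mul, abs_of_nonneg (hd.transProb_nonneg ht n m),
    abs_of_pos (hpos m), mul_div_right_comm]
  exact mul_le_mul_of_nonneg_right (hp.transProb_le hd hpos ht n m) (abs_nonneg x)

theorem Balanced.summable_expCost (hp : q.Balanced d p) (hd : q.IsEfficient d)
    (hpos : ∀ m, 0 < p m) (hs : Summable fun m => p m * q.costRate m (d m)) {t : ℝ} (ht : 0 ≤ t)
    (n : ℕ) : Summable fun m => q.transProb d t n m * q.costRate m (d m) :=
  Summable.of_norm_bounded (hs.abs.div_const (p n)) fun m =>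
    hp.norm_transProb_mul_le hd hpos ht n m _

theorem Balanced.continuousOn_expCost (hp : q.Balanced d p) (hd : q.IsEfficient d)
    (hpos : ∀ m, 0 < p m) (hs : Summable fun m => p m * q.costRate m (d m)) (n : ℕ) :
    ContinuousOn (fun t => q.expCost d t n) (Set.Ici 0) :=
  continuousOn_tsum (fun m => ((hd.continuous_transProb n m).mul continuous_const).continuousOn)
    (hs.abs.div_const (p n)) fun m _ ht => hp.norm_transProb_mul_le hd hpos ht n m _

theorem Balanced.intervalIntegrable_expCost (hp : q.Balanced d p) (hd : q.IsEfficient d)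
    (hpos : ∀ m, 0 < p m) (hs : Summable fun m => p m * q.costRate m (d m)) (n : ℕ) {T : ℝ}
    (hT : 0 ≤ T) : IntervalIntegrable (fun t => q.expCost d t n) MeasureTheory.volume 0 T :=
  ((hp.continuousOn_expCost hd hpos hs n).mono (by
    rw [Set.uIcc_of_le hT]
    exact Set.Icc_subset_Ici_self)).intervalIntegrable

theorem Balanced.hasSum_integral_expCost (hp : q.Balanced d p) (hd : q.IsEfficient d)
    (hpos : ∀ m, 0 < p m) (hs : Summable fun m => p m * q.costRate m (d m)) (n : ℕ) {T : ℝ}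
    (hT : 0 ≤ T) :
    HasSum (fun m => (∫ t in (0 : ℝ)..T, q.transProb d t n m) * q.costRate m (d m))
      (∫ t in (0 : ℝ)..T, q.expCost d t n) := by
  have hmem : ∀ t ∈ Set.uIoc 0 T, 0 ≤ t := fun t ht => by
    rw [Set.uIoc_of_le hT] at ht
    exact ht.1.le
  have h := intervalIntegral.hasSum_integral_of_dominated_convergence
    (μ := MeasureTheory.volume) (a := 0) (b := T)
    (F := fun m t => q.transProb d t n m * q.costRate m (d m))
    (f := fun t => q.expCost d t n)
    (fun m _ => |p m * q.costRate m (d m)| / p n)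
    (fun m => ((hd.continuous_transProb n m).mul continuous_const).aestronglyMeasurable)
    (fun m => Eventually.of_forall fun t ht =>
      hp.norm_transProb_mul_le hd hpos (hmem t ht) n m _)
    (Eventually.of_forall fun t _ => hs.abs.div_const (p n))
    (by simp)
    (Eventually.of_forall fun t ht =>
      (hp.summable_expCost hd hpos hs (hmem t ht) n).hasSum)
  simpa only [intervalIntegral.integral_mul_const] using h

theorem Balanced.serviceRate_pos (hp : q.Balanced d p) (hpos : ∀ m, 0 < p m) (m : ℕ) :
    0 < q.serviceRate (d (m + 1)) :=
  pos_of_mul_pos_left (by rw [← hp m]; exact mul_pos q.arr_pos (hpos m)) (hpos (m + 1)).le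

theorem Balanced.mul_eq_mul (hp : q.Balanced d p) (hpos : ∀ m, 0 < p m) {L : ℕ → ℝ}
    (hL : q.Balanced d L) (m : ℕ) : L m * p 0 = L 0 * p m := by
  induction m with
  | zero => rfl
  | succ m ih =>
    refine mul_left_cancel₀ (hp.serviceRate_pos hpos m).ne' ?_
    have h1 := hp m
    have h2 := hL m
    calc _ = q.arr * L m * p 0 := by rw [h2]; ring
      _ = L 0 * (q.arr * p m) := by rw [mul_assoc, ih]; ring
      _ = _ := by rw [h1]; ring

/-- The time averages converge to the normalized stationary weights. -/
theorem Balanced.tendsto_avgProb (hp : q.Balanced d p) (hd : q.IsEfficient d)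
    (hpos : ∀ m, 0 < p m) {Z : ℝ} (hZ : HasSum p Z) (n m : ℕ) :
    Tendsto (fun T => q.avgProb d T n m) atTop (𝓝 (p m / Z)) := by
  -- Every ultrafilter limit is balanced, hence proportional to `p`; domination by `p m / p n`
  -- preserves total mass one and fixes the factor as `1 / Z`.
  rw [tendsto_iff_ultrafilter]
  intro U hU
  have hpos' : ∀ᶠ T in (U : Filter ℝ), 0 < T := hU (eventually_gt_atTop 0)
  obtain ⟨L, hlim, hL0, hbal⟩ := hd.exists_limit_avgProb n U hU
  have hmass : ∀ T, 0 < T → HasSum (fun m => q.avgProb d T n m) 1 := by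
    intro T hT
    have h := intervalIntegral.hasSum_integral_of_dominated_convergence
      (μ := MeasureTheory.volume) (a := 0) (b := T)
      (F := fun m t => q.transProb d t n m) (f := fun _ => 1)
      (fun m _ => p m / p n)
      (fun m => (hd.continuous_transProb n m).aestronglyMeasurable)
      (fun m => Eventually.of_forall fun t ht => by
        rw [Set.uIoc_of_le hT.le] at ht
        rw [Real.norm_eq_abs, abs_of_nonneg (hd.transProb_nonneg ht.1.le n m)]
        exact hp.transProb_le hd hpos ht.1.le n m)
      (Eventually.of_forall fun t _ => hZ.summable.div_const (p n))
      (by simp)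
      (Eventually.of_forall fun t ht => by
        rw [Set.uIoc_of_le hT.le] at ht
        exact hd.hasSum_transProb ht.1.le n)
    have h' := h.mul_left (1 / T)
    have hT' := hT.ne'
    simpa [hT', avgProb] using h'
  have hle : ∀ T, 0 < T → ∀ m, ‖q.avgProb d T n m‖ ≤ p m / p n := by
    intro T hT m
    rw [Real.norm_eq_abs, abs_of_nonneg (hd.avgProb_nonneg hT.le n m), avgProb]
    have h1 := intervalIntegral.integral_mono_on (μ := MeasureTheory.volume) hT.le
      (hd.intervalIntegrable_transProb n m 0 T) (g := fun _ => p m / p n) (by simp)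
      (fun t ht => hp.transProb_le hd hpos ht.1 n m)
    rw [intervalIntegral.integral_const, sub_zero, smul_eq_mul] at h1
    rw [one_div, inv_mul_le_iff₀ hT]
    exact h1
  have h1 := tendsto_tsum_of_dominated_convergence (𝓕 := (U : Filter ℝ))
    (f := fun T m => q.avgProb d T n m) (g := L) (hZ.summable.div_const (p n)) hlim (by
      filter_upwards [hpos'] with T hT using hle T hT)
  have h2 : ∑' m, L m = 1 := by
    refine tendsto_nhds_unique h1 (tendsto_const_nhds.congr' ?_)
    filter_upwards [hpos'] with T hT using (hmass T hT).tsum_eq.symm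
  have h3 : p 0 = L 0 * Z := by
    rw [← hZ.tsum_eq, ← tsum_mul_left, ← one_mul (p 0), ← h2, ← tsum_mul_right]
    exact tsum_congr fun m => hp.mul_eq_mul hpos hbal m
  have hZ0 : 0 < Z := hZ.tsum_eq ▸ hZ.summable.tsum_pos (fun m => (hpos m).le) 0 (hpos 0)
  have hL : L m = p m / Z := by
    rw [eq_div_iff hZ0.ne']
    refine mul_left_cancel₀ (hpos 0).ne' ?_
    have := hp.mul_eq_mul hpos hbal m
    calc p 0 * (L m * Z) = (L m * p 0) * Z := by ring
      _ = L 0 * Z * p m := by rw [this]; ring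
      _ = _ := by rw [← h3]
  rw [← hL]
  exact hlim m

/-- The average cost of a policy with positive summable stationary weights of finite cost. -/
theorem Balanced.hasAverageCost (hp : q.Balanced d p) (hd : q.IsEfficient d)
    (hpos : ∀ m, 0 < p m) {Z C : ℝ} (hZ : HasSum p Z)
    (hC : HasSum (fun m => p m * q.costRate m (d m)) C) :
    q.HasAverageCost d (C / Z) := by
  intro n
  refine ⟨fun t ht => hp.summable_expCost hd hpos hC.summable ht n,
    fun T hT => hp.intervalIntegrable_expCost hd hpos hC.summable n hT, ?_⟩
  have h1 := tendsto_tsum_of_dominated_convergence (𝓕 := (atTop : Filter ℝ))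
    (f := fun T m => q.avgProb d T n m * q.costRate m (d m))
    (g := fun m => p m / Z * q.costRate m (d m))
    (hC.summable.abs.div_const (p n))
    (fun m => (hp.tendsto_avgProb hd hpos hZ n m).mul_const _) (by
      filter_upwards [eventually_gt_atTop 0] with T hT m
      have h1 := intervalIntegral.norm_integral_le_of_norm_le_const
        (a := 0) (b := T) (f := fun t => q.transProb d t n m * q.costRate m (d m))
        (C := |p m * q.costRate m (d m)| / p n) (fun t ht => by
          rw [Set.uIoc_of_le hT.le] at ht
          exact hp.norm_transProb_mul_le hd hpos ht.1.le n m _)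
      rw [intervalIntegral.integral_mul_const, sub_zero, abs_of_pos hT] at h1
      rw [avgProb, mul_assoc, norm_mul, Real.norm_eq_abs, abs_of_pos (one_div_pos.2 hT), one_div,
        inv_mul_le_iff₀ hT, mul_comm T]
      exact h1)
  have h2 : ∑' m, p m / Z * q.costRate m (d m) = C / Z := by
    rw [← hC.tsum_eq, ← tsum_div_const]
    exact tsum_congr fun m => by ring
  rw [h2] at h1
  refine h1.congr' ?_
  filter_upwards [eventually_gt_atTop 0] with T hT
  rw [← (hp.hasSum_integral_expCost hd hpos hC.summable n hT.le).tsum_eq, ← tsum_mul_left]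
  exact tsum_congr fun m => by rw [avgProb]; ring

/-- The integrated backward equation for the expected cost rate. -/
theorem Balanced.expCost_sub_eq (hp : q.Balanced d p) (hd : q.IsEfficient d)
    (hpos : ∀ m, 0 < p m) (hs : Summable fun m => p m * q.costRate m (d m)) (n : ℕ) {T : ℝ}
    (hT : 0 ≤ T) :
    q.expCost d T n - q.costRate n (d n)
      = ∑ l ∈ range (n + 2), q.generator d n l * ∫ t in (0 : ℝ)..T, q.expCost d t l := by
  have h1 := hasSum_sum (s := range (n + 2)) fun l _ =>
    (hp.hasSum_integral_expCost hd hpos hs l hT).mul_left (q.generator d n l)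
  have h2 : HasSum (fun m => q.transProb d T n m * q.costRate m (d m)
      - q.transProb d 0 n m * q.costRate m (d m))
      (q.expCost d T n - q.costRate n (d n)) := by
    refine (hp.summable_expCost hd hpos hs hT n).hasSum.sub ?_
    refine (hasSum_ite_eq n (q.costRate n (d n))).congr_fun fun m => ?_
    rw [transProb_zero]
    by_cases h : n = m
    · subst h; simp
    · simp [h, Ne.symm h]
  refine h2.unique (h1.congr_fun ?_)
  intro m
  have hi : ∀ l, IntervalIntegrable (fun t => q.generator d n l * q.transProb d t l m)
      MeasureTheory.volume 0 T :=
    fun l => (hd.intervalIntegrable_transProb l m 0 T).const_mul _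
  have h3 := intervalIntegral.integral_eq_sub_of_hasDerivAt (a := 0) (b := T)
    (fun t _ => hd.hasDerivAt_transProb t n m)
    ((continuous_finsetSum _ fun l _ =>
      continuous_const.mul (hd.continuous_transProb l m)).intervalIntegrable 0 T)
  rw [intervalIntegral.integral_finsetSum fun l _ => hi l] at h3
  rw [← sub_mul, ← h3, Finset.sum_mul]
  refine Finset.sum_congr rfl fun l _ => ?_
  rw [intervalIntegral.integral_const_mul, mul_assoc]

/-- Performance potentials solve the Poisson equation. -/
theorem IsPotential.solvesPoisson {η : ℝ} {g : ℕ → ℝ} (hg : q.IsPotential d η g)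
    (hp : q.Balanced d p) (hd : q.IsEfficient d) (hpos : ∀ m, 0 < p m)
    (hs : Summable fun m => p m * q.costRate m (d m)) : q.SolvesPoisson d η g := by
  intro n
  have h0 : ∑ l ∈ range (n + 2), q.generator d n l = 0 := by
    simpa using hd.sum_generator_mul (fun _ => 1) n
  have hsub : ∀ l T, 0 ≤ T → ∫ t in (0 : ℝ)..T, (q.expCost d t l - η)
      = (∫ t in (0 : ℝ)..T, q.expCost d t l) - T * η := fun l T hT => by
    rw [intervalIntegral.integral_sub (hp.intervalIntegrable_expCost hd hpos hs l hT) (by simp)]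
    simp
  have h1 : Tendsto (fun T => q.expCost d T n - η) atTop
      (𝓝 (q.costRate n (d n) - η + ∑ l ∈ range (n + 2), q.generator d n l * g l)) := by
    have := (tendsto_finsetSum (range (n + 2)) fun l _ =>
      (hg l).const_mul (q.generator d n l)).const_add (q.costRate n (d n) - η)
    refine this.congr' ?_
    filter_upwards [eventually_ge_atTop 0] with T hT
    have h2 := hp.expCost_sub_eq hd hpos hs n hT
    simp only [hsub _ T hT, mul_sub, Finset.sum_sub_distrib, ← Finset.sum_mul, h0, zero_mul,
      sub_zero, ← h2]
    ring
  set x := q.costRate n (d n) - η + ∑ l ∈ range (n + 2), q.generator d n l * g l with hx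
  -- Integrals over `[T, T + 1]` vanish in the limit because those over `[0, T]` converge. They also
  -- tend to the limit `x` of the integrand, so `x = 0`.
  have h3 : Tendsto (fun T : ℝ => ∫ t in T..(T + 1), (q.expCost d t n - η)) atTop (𝓝 0) := by
    have h4 := ((hg n).comp (tendsto_atTop_add_const_right atTop (1 : ℝ) tendsto_id)).sub (hg n)
    rw [sub_self] at h4
    refine h4.congr' ?_
    filter_upwards [eventually_ge_atTop 0] with T hT
    have hi : ∀ S, 0 ≤ S → IntervalIntegrable (fun t => q.expCost d t n - η)
        MeasureTheory.volume 0 S := fun S hS =>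
      (hp.intervalIntegrable_expCost hd hpos hs n hS).sub (by simp)
    exact intervalIntegral.integral_interval_sub_left (hi _ (by positivity)) (hi _ hT)
  have h5 : Tendsto (fun T : ℝ => ∫ t in T..(T + 1), (q.expCost d t n - η)) atTop (𝓝 x) := by
    rw [Metric.tendsto_atTop]
    intro ε hε
    obtain ⟨N, hN⟩ := Metric.tendsto_atTop.1 h1 (ε / 2) (half_pos hε)
    refine ⟨max N 0, fun T hT => ?_⟩
    have hT0 : 0 ≤ T := (le_max_right _ _).trans hT
    have hi : IntervalIntegrable (fun t => q.expCost d t n - η)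
        MeasureTheory.volume T (T + 1) := by
      refine IntervalIntegrable.sub ?_ (by simp)
      refine ((hp.continuousOn_expCost hd hpos hs n).mono ?_).intervalIntegrable
      rw [Set.uIcc_of_le (by linarith)]
      exact fun t ht => hT0.trans ht.1
    have h6 : (∫ t in T..(T + 1), (q.expCost d t n - η)) - x
        = ∫ t in T..(T + 1), (q.expCost d t n - η - x) := by
      rw [intervalIntegral.integral_sub hi (by simp)]
      simp
    have h7 := intervalIntegral.norm_integral_le_of_norm_le_const
      (a := T) (b := T + 1) (f := fun t => q.expCost d t n - η - x) (C := ε / 2) (fun t ht => by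
        rw [Set.uIoc_of_le (by linarith)] at ht
        exact (hN t (((le_max_left _ _).trans hT).trans ht.1.le)).le)
    rw [Real.dist_eq, h6]
    rw [Real.norm_eq_abs] at h7
    refine h7.trans_lt ?_
    simp only [add_sub_cancel_left, abs_one, mul_one]
    linarith
  exact tendsto_nhds_unique h5 h3

end Positive

/-! ### Comparison with policies that idle. -/

variable {η : ℝ}

theorem eq_zero_of_serviceRate_eq_zero {a : Fin K → ℕ} (h : q.serviceRate a = 0) : a = 0 := by
  funext k
  have h1 := (Finset.sum_eq_zero_iff_of_nonneg fun k _ =>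
    mul_nonneg (Nat.cast_nonneg (a k)) (q.mu_pos k).le).1 h k (Finset.mem_univ k)
  simpa [(q.mu_pos k).ne'] using h1

theorem serviceRate_single (q : GroupServerQueue K) (k : Fin K) :
    q.serviceRate (Pi.single k 1) = q.mu k := by
  rw [serviceRate, Finset.sum_eq_single k] <;> simp +contextual

theorem costRate_single (q : GroupServerQueue K) (n : ℕ) (k : Fin K) :
    q.costRate n (Pi.single k 1) = q.h n + q.c k := by
  rw [costRate, Finset.sum_eq_single k] <;> simp +contextual

theorem costRate_zero (q : GroupServerQueue K) (n : ℕ) : q.costRate n 0 = q.h n := by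
  simp [costRate]

theorem IsEfficient.update (hd : q.IsEfficient d) {n : ℕ} {a : Fin K → ℕ}
    (ha : (∀ k, a k ≤ q.M k) ∧ ∑ k, a k ≤ n) : q.IsEfficient (Function.update d n a) := by
  intro m
  rcases eq_or_ne m n with rfl | h
  · simpa using ha
  · simpa [h] using hd m

/-- There is a server of least operating cost per unit of service. -/
theorem exists_cheapest_server {b : Fin K → ℕ} (hb : ∀ k, b k ≤ q.M k)
    (hpos : 0 < q.serviceRate b) :
    ∃ k, 0 < q.M k ∧ ∀ n (a : Fin K → ℕ), (∀ k, a k ≤ q.M k) →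
      q.h n + q.c k / q.mu k * q.serviceRate a ≤ q.costRate n a := by
  have hne : (Finset.univ.filter fun k => 0 < q.M k).Nonempty := by
    by_contra h
    rw [Finset.not_nonempty_iff_eq_empty, Finset.filter_eq_empty_iff] at h
    have : b = 0 := funext fun k => Nat.le_zero.1 ((hb k).trans (not_lt.1 (h (mem_univ k))))
    rw [this, serviceRate_zero] at hpos
    exact lt_irrefl _ hpos
  obtain ⟨k, hk, hmin⟩ := Finset.exists_min_image _ (fun k => q.c k / q.mu k) hne
  refine ⟨k, (Finset.mem_filter.1 hk).2, fun n a ha => ?_⟩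
  rw [costRate, serviceRate, Finset.mul_sum]
  refine add_le_add_right (Finset.sum_le_sum fun i _ => ?_) _
  rcases Nat.eq_zero_or_pos (a i) with h0 | h0
  · simp [h0]
  · have h1 := hmin i (Finset.mem_filter.2 ⟨mem_univ i, h0.trans_le (ha i)⟩)
    rw [le_div_iff₀ (q.mu_pos i)] at h1
    calc _ = (a i : ℝ) * (q.c k / q.mu k * q.mu i) := by ring
      _ ≤ _ := mul_le_mul_of_nonneg_left h1 (Nat.cast_nonneg _)

section Balanced

variable {p : ℕ → ℝ}

/-- In stationarity the mean service rate is the arrival rate. -/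
theorem Balanced.hasSum_mul_serviceRate (hp : q.Balanced d p) (hd : q.IsEfficient d) {Z : ℝ}
    (hZ : HasSum p Z) : HasSum (fun m => p m * q.serviceRate (d m)) (q.arr * Z) := by
  rw [← hasSum_nat_add_iff' 1]
  simp only [Finset.range_one, Finset.sum_singleton, hd.serviceRate_apply_zero, mul_zero, sub_zero]
  refine (hZ.mul_left q.arr).congr_fun fun m => ?_
  rw [hp m, mul_comm]

/-- The chain cannot step down from `n`, so detailed balance forces `p (n - 1) = 0`, and then zero
weight in each state below. -/
theorem Balanced.eq_zero_of_lt (hp : q.Balanced d p) {n : ℕ} (hn : q.serviceRate (d n) = 0)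
    {m : ℕ} (hm : m < n) : p m = 0 := by
  have hstep : ∀ i, q.arr * p i = 0 → p i = 0 := fun i h =>
    (mul_eq_zero.1 h).resolve_left q.arr_pos.ne'
  obtain ⟨j, rfl⟩ := Nat.exists_eq_add_of_lt hm
  induction j generalizing m with
  | zero => exact hstep m (by rw [hp m, show m + 1 = m + 0 + 1 from rfl, hn, zero_mul])
  | succ j ih =>
    refine hstep m ?_
    have h1 : m + 1 + j + 1 = m + (j + 1) + 1 := by omega
    rw [hp m, ih (m := m + 1) (by rw [h1]; exact hn) (by omega), mul_zero]

theorem Balanced.pos_of_le (hp : q.Balanced d p) (hp0 : ∀ m, 0 ≤ p m) (hne : ∃ m, 0 < p m) {n : ℕ}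
    (hn : q.serviceRate (d n) = 0) (hs : ∀ m, n < m → 0 < q.serviceRate (d m)) :
    ∀ m, n ≤ m → 0 < p m := by
  have hpn : 0 < p n := by
    refine lt_of_le_of_ne (hp0 n) fun h => ?_
    have hz : ∀ m, n ≤ m → p m = 0 := by
      intro m hm
      induction m, hm using Nat.le_induction with
      | base => exact h.symm
      | succ m hm ih =>
        have h1 := hp m
        rw [ih, mul_zero, eq_comm] at h1
        exact (mul_eq_zero.1 h1).resolve_left (hs _ (Nat.lt_succ_of_le hm)).ne'
    obtain ⟨m, hm⟩ := hne
    rcases lt_or_ge m n with h1 | h1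
    · exact hm.ne' (hp.eq_zero_of_lt hn h1)
    · exact hm.ne' (hz m h1)
  intro m hm
  induction m, hm using Nat.le_induction with
  | base => exact hpn
  | succ m hm ih =>
    exact pos_of_mul_pos_right (by rw [← hp m]; exact mul_pos q.arr_pos ih)
      (q.serviceRate_nonneg _)

theorem IsOptimal.nonneg_of_pos (hopt : q.IsOptimal d η) {d' : ℕ → Fin K → ℕ}
    (hd' : q.IsEfficient d') (hp : q.Balanced d' p) (hpos : ∀ m, 0 < p m) (hs : Summable p) {S : ℝ}
    (hS : HasSum (fun m => p m * (q.costRate m (d' m) - η)) S) : 0 ≤ S := by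
  have hC : HasSum (fun m => p m * q.costRate m (d' m)) (S + (∑' m, p m) * η) :=
    (hS.add (hs.hasSum.mul_right η)).congr_fun fun m => by ring
  have h1 := hopt.2.2 d' _ hd' (hp.hasAverageCost hd' hpos hs.hasSum hC)
  rw [le_div_iff₀ (hs.tsum_pos (fun m => (hpos m).le) 0 (hpos 0))] at h1
  linarith

/-- The stationary cost of an idling policy exceeds the holding cost in its least recurrent state
together with the least cost of serving the arrivals. -/
theorem Balanced.lt_of_hasSum (hp : q.Balanced d p) (hd : q.IsEfficient d) {n : ℕ} {Z C r : ℝ}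
    (hzero : ∀ m, m < n → p m = 0) (hpos : ∀ m, n ≤ m → 0 < p m) (hZ : HasSum p Z)
    (hC : HasSum (fun m => p m * q.costRate m (d m)) C)
    (hr : ∀ n (a : Fin K → ℕ), (∀ k, a k ≤ q.M k) →
      q.h n + r * q.serviceRate a ≤ q.costRate n a) :
    Z * (q.h n + r * q.arr) < C := by
  -- This sums the cost in excess of `h n` and of `r` per unit of service; the mean service rate is
  -- `q.arr`. Strictness comes from a state `N` with `h N > h n`.
  have h1 := (hC.sub (hZ.mul_right (q.h n))).sub ((hp.hasSum_mul_serviceRate hd hZ).mul_left r)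
  have hterm : ∀ m, p m * (q.h m - q.h n) ≤ p m * q.costRate m (d m) - p m * q.h n
      - r * (p m * q.serviceRate (d m)) := by
    intro m
    have hpm : 0 ≤ p m := by
      rcases lt_or_ge m n with h | h
      · exact (hzero m h).ge
      · exact (hpos m h).le
    have := mul_le_mul_of_nonneg_left (hr m (d m) (hd m).1) hpm
    linarith
  have hterm0 : ∀ m, 0 ≤ p m * (q.h m - q.h n) := by
    intro m
    rcases lt_or_ge m n with h | h
    · rw [hzero m h, zero_mul]
    · exact mul_nonneg (hpos m h).le (sub_nonneg.2 (q.h_mono h))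
  obtain ⟨N, hN⟩ := (q.h_tendsto.eventually_gt_atTop (q.h n)).exists
  have hnN : n ≤ N := by
    by_contra! h
    exact absurd (q.h_mono h.le) (not_le.2 hN)
  have h2 := le_hasSum h1 N fun m _ => (hterm0 m).trans (hterm m)
  have h3 := mul_pos (hpos N hnN) (sub_pos.2 hN)
  have h4 := hterm N
  linarith

/-- Serving customers with the cheapest server in the least recurrent state improves a policy that
idles there, so its cost exceeds the optimal cost. -/
theorem IsOptimal.nonneg_of_idle (hopt : q.IsOptimal d η) (n : ℕ) :
    ∀ {d' : ℕ → Fin K → ℕ} {p : ℕ → ℝ} {S : ℝ}, q.IsEfficient d' → q.Balanced d' p →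
      (∀ m, 0 ≤ p m) → (∃ m, 0 < p m) → Summable p →
      HasSum (fun m => p m * (q.costRate m (d' m) - η)) S →
      q.serviceRate (d' n) = 0 → (∀ m, n < m → 0 < q.serviceRate (d' m)) →
      0 ≤ S ∧ (0 < n → 0 < S) := by
  induction n with
  | zero =>
    intro d' p S hd' hp hp0 hne hs hS hidle hserve
    exact ⟨hopt.nonneg_of_pos hd' hp (fun m => hp.pos_of_le hp0 hne hidle hserve m m.zero_le) hs hS,
      fun h => absurd h (lt_irrefl 0)⟩
  | succ n ih =>
    intro d' p S hd' hp hp0 hne hs hS hidle hserve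
    suffices h : 0 < S from ⟨h.le, fun _ => h⟩
    have hpos := hp.pos_of_le hp0 hne hidle hserve
    have hzero : ∀ m, m < n + 1 → p m = 0 := fun m hm => hp.eq_zero_of_lt hidle hm
    obtain ⟨k, hk, hcheap⟩ := exists_cheapest_server (hd' (n + 2)).1 (hserve _ (Nat.lt_succ_self _))
    have hμ := q.mu_pos k
    have harr := q.arr_pos
    have hpn := hpos (n + 1) le_rfl
    by_contra! hS0
    have hC : HasSum (fun m => p m * q.costRate m (d' m)) (S + (∑' m, p m) * η) :=
      (hS.add (hs.hasSum.mul_right η)).congr_fun fun m => by ring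
    have h1 := hp.lt_of_hasSum hd' hzero hpos hs.hasSum hC hcheap
    have hZ : 0 < ∑' m, p m := hs.tsum_pos hp0 (n + 1) hpn
    have h2 : q.h (n + 1) + q.c k / q.mu k * q.arr < η :=
      lt_of_mul_lt_mul_left (by linarith) hZ.le
    -- The weight of `n` forced by detailed balance once the cheapest server works in `n + 1`.
    set y := q.mu k * p (n + 1) / q.arr with hy
    have hy0 : 0 < y := by positivity
    -- Idling in `n` keeps the weights below `n` zero, so the induction hypothesis applies to `e`.
    let e := Function.update (Function.update d' (n + 1) (Pi.single k 1)) n 0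
    have he : q.IsEfficient e := by
      refine (hd'.update ⟨fun i => ?_, ?_⟩).update ⟨fun i => Nat.zero_le _, by simp⟩
      · rcases eq_or_ne i k with rfl | h
        · simpa using Nat.one_le_of_lt hk
        · simp [h]
      · simp
    have hen : e n = 0 := by simp [e]
    have hen1 : e (n + 1) = Pi.single k 1 := by simp [e]
    have heq : ∀ m, m ≠ n → m ≠ n + 1 → e m = d' m := fun m h h' => by simp [e, h, h']
    have hpe : q.Balanced e (Function.update p n y) := by
      intro m
      rcases lt_trichotomy (m + 1) n with h | h | h
      · rw [Function.update_of_ne (by omega), Function.update_of_ne (by omega),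
          hzero m (by omega), hzero (m + 1) (by omega), mul_zero, mul_zero]
      · rw [h, hen, serviceRate_zero, Function.update_of_ne (by omega), hzero m (by omega),
          mul_zero, zero_mul]
      · rcases Nat.eq_or_lt_of_le (Nat.lt_succ_iff.1 h) with rfl | h'
        · rw [hen1, serviceRate_single, Function.update_self,
            Function.update_of_ne (by omega), hy]
          field_simp
        · rw [Function.update_of_ne (by omega), Function.update_of_ne (by omega),
            heq (m + 1) (by omega) (by omega), hp m]
    have hsum := (hS.update (n + 1) (p (n + 1) * (q.costRate (n + 1) (Pi.single k 1) - η))).update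
      n (y * (q.costRate n 0 - η))
    have hfun : Function.update (Function.update
        (fun m => p m * (q.costRate m (d' m) - η)) (n + 1)
          (p (n + 1) * (q.costRate (n + 1) (Pi.single k 1) - η)))
        n (y * (q.costRate n 0 - η))
        = fun m => Function.update p n y m * (q.costRate m (e m) - η) := by
      funext m
      rcases eq_or_ne m n with rfl | h
      · simp [hen]
      · rcases eq_or_ne m (n + 1) with rfl | h'
        · simp [hen1]
        · simp [h, h', heq m h h']
    rw [hfun] at hsum
    have h3 := (ih he hpe
      (fun m => by
        rcases eq_or_ne m n with rfl | h
        · simpa using hy0.le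
        · simpa [h] using hp0 m)
      ⟨n, by simpa using hy0⟩ (hs.hasSum.update n y).summable hsum
      (by rw [hen, serviceRate_zero])
      (fun m hm => by
        rcases eq_or_ne m (n + 1) with rfl | h'
        · rw [hen1, serviceRate_single]; exact hμ
        · rw [heq m (by omega) h']; exact hserve m (by omega))).1
    rw [Function.update_of_ne (by omega), hzero n (by omega), eq_zero_of_serviceRate_eq_zero hidle,
      costRate_zero, costRate_zero, costRate_single] at h3
    have h4 : q.h n ≤ q.h (n + 1) := q.h_mono (Nat.le_succ n)
    have h5 : y * (q.c k / q.mu k * q.arr) = p (n + 1) * q.c k := by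
      rw [hy]; field_simp
    -- This is the change of the stationary sum from the old policy to `e`. It is negative by `h2`,
    -- which contradicts nonnegativity for `e`.
    have h6 : y * (q.h n + q.c k / q.mu k * q.arr - η) < 0 :=
      mul_neg_of_pos_of_neg hy0 (by linarith)
    nlinarith

/-- Stationary weights of any efficient policy have at least the optimal cost; if the policy idles
in a state with customers, then they have more. -/
theorem IsOptimal.nonneg_of_balanced (hopt : q.IsOptimal d η) {d' : ℕ → Fin K → ℕ}
    (hd' : q.IsEfficient d') (hp : q.Balanced d' p) (hp0 : ∀ m, 0 ≤ p m) (hne : ∃ m, 0 < p m)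
    (hs : Summable p) {S : ℝ} (hS : HasSum (fun m => p m * (q.costRate m (d' m) - η)) S) :
    0 ≤ S ∧ ∀ n, 0 < n → q.serviceRate (d' n) = 0 → 0 < S := by
  classical
  obtain ⟨M, hM⟩ := hne
  have hbound : ∀ n, q.serviceRate (d' n) = 0 → n ≤ M := fun n hn => by
    by_contra! h
    exact hM.ne' (hp.eq_zero_of_lt hn h)
  -- The largest idle state is the least recurrent one; idle states are bounded by any state of
  -- positive weight.
  set N := Nat.findGreatest (fun n => q.serviceRate (d' n) = 0) M with hN
  have hidle : q.serviceRate (d' N) = 0 :=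
    Nat.findGreatest_spec (P := fun n => q.serviceRate (d' n) = 0) (Nat.zero_le M)
      hd'.serviceRate_apply_zero
  have hmax : ∀ m, q.serviceRate (d' m) = 0 → m ≤ N := fun m hm =>
    Nat.le_findGreatest (hbound m hm) hm
  have h := hopt.nonneg_of_idle N hd' hp hp0 ⟨M, hM⟩ hs hS hidle fun m hm =>
    lt_of_le_of_ne (q.serviceRate_nonneg _) fun h => absurd (hmax m h.symm) (not_le.2 hm)
  exact ⟨h.1, fun n hn hn' => h.2 (hn.trans_le (hmax n hn'))⟩

end Balanced

/-- An optimal policy serves whenever there are customers, and has positive stationary weights whose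
cost is the optimal cost. -/
theorem IsOptimal.exists_balanced (hopt : q.IsOptimal d η) :
    ∃ p : ℕ → ℝ, q.Balanced d p ∧ (∀ m, 0 < p m) ∧ Summable p ∧
      HasSum (fun m => p m * (q.costRate m (d m) - η)) 0 := by
  obtain ⟨p, hp, hp0, hne, hs, S, hS0, hS⟩ := hopt.2.1.exists_balanced hopt.1
  obtain ⟨h1, h2⟩ := hopt.nonneg_of_balanced hopt.1 hp hp0 hne hs hS
  obtain rfl : S = 0 := le_antisymm hS0 h1
  refine ⟨p, hp, fun m => hp.pos_of_le hp0 hne hopt.1.serviceRate_apply_zero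
    (fun n hn => ?_) m m.zero_le, hs, hS⟩
  exact lt_of_le_of_ne (q.serviceRate_nonneg _) fun h => lt_irrefl _ (h2 n hn h.symm)

/-! ### Rewards, server exchange and the recursion for the realization factor. -/

/-- Rate of reward for the action `a` if each service earns `x`. -/
def reward (q : GroupServerQueue K) (a : Fin K → ℕ) (x : ℝ) : ℝ :=
  ∑ k, (a k : ℝ) * (q.mu k * x - q.c k)

theorem costRate_eq_sub_reward (q : GroupServerQueue K) (n : ℕ) (a : Fin K → ℕ) (x : ℝ) :
    q.costRate n a = q.h n + q.serviceRate a * x - q.reward a x := by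
  rw [costRate, serviceRate, reward, Finset.sum_mul, add_sub_assoc, ← Finset.sum_sub_distrib]
  exact congrArg _ (Finset.sum_congr rfl fun k _ => by ring)

theorem reward_zero (q : GroupServerQueue K) (x : ℝ) : q.reward 0 x = 0 := by simp [reward]

theorem reward_mono (q : GroupServerQueue K) (a : Fin K → ℕ) : Monotone (q.reward a) :=
  fun _ _ hxy => Finset.sum_le_sum fun k _ => mul_le_mul_of_nonneg_left
    (sub_le_sub_right (mul_le_mul_of_nonneg_left hxy (q.mu_pos k).le) _) (Nat.cast_nonneg _)

theorem reward_add (q : GroupServerQueue K) (a b : Fin K → ℕ) (x : ℝ) :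
    q.reward (a + b) x = q.reward a x + q.reward b x := by
  simp only [reward, Pi.add_apply, Nat.cast_add, add_mul, Finset.sum_add_distrib]

theorem reward_single (q : GroupServerQueue K) (k : Fin K) (x : ℝ) :
    q.reward (Pi.single k 1) x = q.mu k * x - q.c k := by
  rw [reward, Finset.sum_eq_single k] <;> simp +contextual

/-- The actions that are efficient in the state `n`. -/
def IsAction (q : GroupServerQueue K) (n : ℕ) (a : Fin K → ℕ) : Prop :=
  (∀ k, a k ≤ q.M k) ∧ ∑ k, a k ≤ n

/-- A server can be moved from the larger state to the smaller one without loss of reward. -/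
theorem IsAction.exchange {m n : ℕ} (hnm : n ≤ m) {a b : Fin K → ℕ} (ha : q.IsAction (m + 1) a)
    (hb : q.IsAction n b) {x y : ℝ} (hxy : x ≤ y) :
    ∃ a' b', q.IsAction m a' ∧ q.IsAction (n + 1) b' ∧
      q.reward a x + q.reward b y ≤ q.reward a' x + q.reward b' y := by
  rcases Nat.lt_or_ge m (∑ k, a k) with h | h
  · obtain ⟨k, -, hk⟩ := Finset.exists_lt_of_sum_lt (hb.2.trans_lt (hnm.trans_lt h))
    have hle : Pi.single k 1 ≤ a := by
      intro i
      rcases eq_or_ne i k with rfl | hi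
      · simpa using Nat.one_le_of_lt hk
      · simp [hi]
    have hadd : a - Pi.single k 1 + Pi.single k 1 = a := tsub_add_cancel_of_le hle
    have hsum : ∑ i, (a - Pi.single k 1 : Fin K → ℕ) i + 1 = ∑ i, a i := by
      conv_rhs => rw [← hadd]
      simp only [Pi.add_apply, Finset.sum_add_distrib, Finset.sum_pi_single', Finset.mem_univ,
        if_true]
    refine ⟨a - Pi.single k 1, b + Pi.single k 1,
      ⟨fun i => (Nat.sub_le _ _).trans (ha.1 i), ?_⟩, ⟨fun i => ?_, ?_⟩, ?_⟩
    · have := ha.2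
      omega
    · rcases eq_or_ne i k with rfl | hi
      · simpa using (Nat.succ_le_of_lt hk).trans (ha.1 i)
      · simpa [hi] using hb.1 i
    · simp only [Pi.add_apply, Finset.sum_add_distrib, Finset.sum_pi_single', Finset.mem_univ,
        if_true]
      exact Nat.succ_le_succ hb.2
    · rw [reward_add, reward_single]
      conv_lhs => rw [← hadd]
      rw [reward_add, reward_single]
      have := mul_le_mul_of_nonneg_left hxy (q.mu_pos k).le
      linarith
  · exact ⟨a, b, ⟨ha.1, h⟩, ⟨hb.1, hb.2.trans (Nat.le_succ n)⟩, le_rfl⟩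

/-- For `n = 0` truncated subtraction gives `prf g 0 = 0`, and the reward vanishes because no server
is on. -/
theorem SolvesPoisson.arr_mul_prf {g : ℕ → ℝ} (hg : q.SolvesPoisson d η g) (hd : q.IsEfficient d)
    (n : ℕ) : q.arr * prf g (n + 1) = η - q.h n + q.reward (d n) (prf g n) := by
  have h1 := hg n
  rw [hd.sum_generator_mul, q.costRate_eq_sub_reward n (d n) (prf g n)] at h1
  rw [prf, Nat.add_sub_cancel]
  rw [prf] at h1 ⊢
  linarith

/-! ### Policy improvement and monotonicity. -/

section Improvement

variable {p g : ℕ → ℝ}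

/-- Weighted by `p`, the recursion telescopes, because detailed balance matches the service term in
`n + 1` with the arrival term in `n`. -/
theorem SolvesPoisson.sum_mul_costRate (hg : q.SolvesPoisson d η g) (hd : q.IsEfficient d)
    (hp : q.Balanced d p) (n : ℕ) :
    ∑ m ∈ range (n + 1), p m * (q.costRate m (d m) - η) = -(q.arr * p n * prf g (n + 1)) := by
  have hrec : ∀ n, q.arr * prf g (n + 1)
      = η - q.costRate n (d n) + q.serviceRate (d n) * prf g n := fun n => by
    rw [hg.arr_mul_prf hd, q.costRate_eq_sub_reward n (d n) (prf g n)]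
    ring
  induction n with
  | zero =>
    have := hrec 0
    rw [hd.serviceRate_apply_zero, zero_mul] at this
    rw [Finset.sum_range_one, mul_right_comm, this]
    ring
  | succ n ih =>
    rw [Finset.sum_range_succ, ih, hp n, mul_right_comm q.arr, hrec (n + 1)]
    ring

/-- The full stationary sum is zero, so minus a partial sum is a tail, whose terms are nonnegative
far out. -/
theorem SolvesPoisson.eventually_prf_nonneg (hg : q.SolvesPoisson d η g) (hd : q.IsEfficient d)
    (hp : q.Balanced d p) (hpos : ∀ m, 0 < p m)
    (hS : HasSum (fun m => p m * (q.costRate m (d m) - η)) 0) :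
    ∃ N, ∀ n, N ≤ n → 0 ≤ prf g (n + 1) := by
  obtain ⟨N, hN⟩ := q.exists_le_costRate η
  refine ⟨N, fun n hn => ?_⟩
  have h1 := (hasSum_nat_add_iff' (n + 1)).2 hS
  have h2 := h1.nonneg fun m => mul_nonneg (hpos _).le
    (sub_nonneg.2 (hN (m + (n + 1)) (by omega) (d _)))
  rw [hg.sum_mul_costRate hd hp, zero_sub, neg_neg] at h2
  exact nonneg_of_mul_nonneg_right h2 (mul_pos q.arr_pos (hpos n))

/-- In every state an optimal policy maximizes the reward at the realization factor. -/
theorem IsOptimal.reward_le (hopt : q.IsOptimal d η) (hg : q.SolvesPoisson d η g)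
    (hp : q.Balanced d p) (hpos : ∀ m, 0 < p m) (hs : Summable p)
    (hS : HasSum (fun m => p m * (q.costRate m (d m) - η)) 0) {n : ℕ} {a : Fin K → ℕ}
    (ha : q.IsAction n a) : q.reward a (prf g n) ≤ q.reward (d n) (prf g n) := by
  have hd := hopt.1
  cases n with
  | zero =>
    have h0 : a = 0 := funext fun k =>
      Finset.sum_eq_zero_iff.1 (Nat.le_zero.1 ha.2) k (Finset.mem_univ k)
    rw [h0, hd.apply_zero]
  | succ n =>
    have hrate := hp.serviceRate_pos hpos n
    -- Changing the action only in `n + 1` keeps detailed balance if the weights below are scaled by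
    -- `κ`. For `a = 0` this is `κ = 0`, which is why idling policies had to be covered.
    set κ := q.serviceRate a / q.serviceRate (d (n + 1)) with hκ
    have hκ0 : 0 ≤ κ := div_nonneg (q.serviceRate_nonneg a) hrate.le
    let p' : ℕ → ℝ := fun m => if m < n + 1 then κ * p m else p m
    let d' := Function.update d (n + 1) a
    have hd' : q.IsEfficient d' := hd.update ha
    have hp' : q.Balanced d' p' := by
      intro m
      rcases lt_trichotomy m n with h | rfl | h
      · simp only [p', d', if_pos (show m < n + 1 by omega), if_pos (show m + 1 < n + 1 by omega),
          Function.update_of_ne (show m + 1 ≠ n + 1 by omega)]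
        rw [mul_left_comm, hp m, mul_left_comm]
      · simp only [p', d', if_pos (Nat.lt_succ_self m), if_neg (lt_irrefl (m + 1)),
          Function.update_self]
        rw [mul_left_comm, hp m, ← mul_assoc, hκ, div_mul_cancel₀ _ hrate.ne']
      · simp only [p', d', if_neg (show ¬ m < n + 1 by omega),
          if_neg (show ¬ m + 1 < n + 1 by omega),
          Function.update_of_ne (show m + 1 ≠ n + 1 by omega)]
        exact hp m
    have hs' : Summable p' := by
      rw [← summable_nat_add_iff (n + 1)] at hs ⊢
      exact hs.congr fun m => (if_neg (by omega)).symm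
    let corr : ℕ → ℝ := fun m => p' m * (q.costRate m (d' m) - η)
      - p m * (q.costRate m (d m) - η)
    have hcorr : HasSum corr (∑ m ∈ range (n + 2), corr m) := by
      refine hasSum_sum_of_ne_finset_zero fun m hm => ?_
      have hm' : n + 2 ≤ m := by simpa using hm
      simp only [corr, p', d', if_neg (show ¬ m < n + 1 by omega),
        Function.update_of_ne (show m ≠ n + 1 by omega), sub_self]
    have hsum : ∑ m ∈ range (n + 2), corr m
        = -((κ - 1) * (q.arr * p n * prf g (n + 1)))
          + p (n + 1) * (q.costRate (n + 1) a - q.costRate (n + 1) (d (n + 1))) := by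
      rw [Finset.sum_range_succ, ← mul_neg, ← hg.sum_mul_costRate hd hp, Finset.mul_sum]
      congr 1
      · refine Finset.sum_congr rfl fun m hm => ?_
        have hm' := Finset.mem_range.1 hm
        simp only [corr, p', d', if_pos hm', Function.update_of_ne hm'.ne]
        ring
      · simp [corr, p', d']
        ring
    have hfin := (hopt.nonneg_of_balanced hd' hp'
      (fun m => by
        simp only [p']
        split_ifs
        · exact mul_nonneg hκ0 (hpos m).le
        · exact (hpos m).le)
      ⟨n + 1, by simpa [p'] using hpos (n + 1)⟩ hs'
      ((hS.add hcorr).congr_fun fun m => by simp only [corr]; ring)).1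
    rw [hsum, hp n, q.costRate_eq_sub_reward _ a (prf g (n + 1)),
      q.costRate_eq_sub_reward _ (d (n + 1)) (prf g (n + 1))] at hfin
    -- With `q.arr * p n` rewritten by detailed balance, this cancels the service-rate terms and
    -- leaves only the difference of rewards.
    have h1 : κ * q.serviceRate (d (n + 1)) = q.serviceRate a := div_mul_cancel₀ _ hrate.ne'
    have h2 : 0 ≤ p (n + 1) * (q.reward (d (n + 1)) (prf g (n + 1))
        - q.reward a (prf g (n + 1))) := by
      rw [← h1] at hfin
      linarith
    exact sub_nonneg.1 (nonneg_of_mul_nonneg_right h2 (hpos (n + 1)))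

/-- The realization factors of an optimal policy increase. -/
theorem IsOptimal.monotone_prf (hopt : q.IsOptimal d η) (hg : q.SolvesPoisson d η g)
    (hp : q.Balanced d p) (hpos : ∀ m, 0 < p m) (hs : Summable p)
    (hS : HasSum (fun m => p m * (q.costRate m (d m) - η)) 0) : Monotone (prf g) := by
  classical
  have hd := hopt.1
  have harr := q.arr_pos
  have hact : ∀ n, q.IsAction n (d n) := hd
  have hmax : ∀ {n a}, q.IsAction n a → q.reward a (prf g n) ≤ q.reward (d n) (prf g n) :=
    fun ha => hopt.reward_le hg hp hpos hs hS ha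
  have hrec := hg.arr_mul_prf hd
  have hG0 : prf g 0 = 0 := sub_self _
  have hη : q.h 0 ≤ η := by
    have h1 := hasSum_le (fun m => mul_le_mul_of_nonneg_left (sub_le_sub_right
      ((q.h_mono m.zero_le).trans (q.le_costRate m (d m))) η) (hpos m).le)
      (hs.hasSum.mul_right (q.h 0 - η)) hS
    have h2 : 0 < ∑' m, p m := hs.tsum_pos (fun m => (hpos m).le) 0 (hpos 0)
    by_contra! h3
    exact absurd h1 (not_le.2 (mul_pos h2 (sub_pos.2 h3)))
  have hG1 : prf g 0 ≤ prf g 1 := by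
    have h1 := hrec 0
    rw [hd.apply_zero, reward_zero, add_zero, zero_add] at h1
    rw [hG0]
    exact nonneg_of_mul_nonneg_right (by rw [h1]; exact sub_nonneg.2 hη) harr
  have hconv : Monotone fun n => q.h (n + 1) - q.h n := monotone_nat_of_le_succ q.h_convex
  refine monotone_nat_of_le_succ fun i => ?_
  by_contra! hi
  have hex : ∃ i, prf g (i + 1) < prf g i := ⟨i, hi⟩
  obtain ⟨n, hn⟩ : ∃ n, Nat.find hex = n + 1 := by
    refine Nat.exists_eq_succ_of_ne_zero fun h => ?_
    have := Nat.find_spec hex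
    rw [h] at this
    exact absurd hG1 (not_le.2 this)
  have hdesc : prf g (n + 2) < prf g (n + 1) := by
    have := Nat.find_spec hex
    rwa [hn] at this
  have hasc : prf g n ≤ prf g (n + 1) := not_lt.1 (Nat.find_min hex (by omega))
  -- Exchange at `x = prf g (m + 1)` and `y = prf g (n + 1)`; monotone rewards and maximality then
  -- compare the two increments of the recursion, and convexity handles the holding costs.
  have hstep : ∀ m, n ≤ m → prf g (m + 1) ≤ prf g m → prf g (m + 1) ≤ prf g (n + 1) →
      prf g (m + 2) - prf g (m + 1) ≤ prf g (n + 2) - prf g (n + 1) := by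
    intro m hnm h1 h2
    obtain ⟨a, b, ha, hb, hab⟩ := (hact (m + 1)).exchange hnm (hact n) h2
    have h3 := (q.reward_mono a h1).trans (hmax ha)
    have h4 := hmax hb
    have h5 := q.reward_mono (d n) hasc
    have h6 := hconv hnm
    simp only at h6
    have e1 := hrec m
    have e2 := hrec (m + 1)
    have e3 := hrec n
    have e4 := hrec (n + 1)
    refine le_of_mul_le_mul_left ?_ harr
    rw [mul_sub, mul_sub, e1, e2, e3, e4]
    linarith
  have hall : ∀ j, prf g (n + j + 2) - prf g (n + j + 1) ≤ prf g (n + 2) - prf g (n + 1) ∧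
      prf g (n + j + 1) ≤ prf g (n + 1) := by
    intro j
    induction j with
    | zero => exact ⟨le_rfl, le_rfl⟩
    | succ j ih =>
      have h1 : prf g (n + j + 1 + 1) ≤ prf g (n + j + 1) := by linarith [ih.1]
      exact ⟨hstep (n + j + 1) (by omega) h1 (h1.trans ih.2), h1.trans ih.2⟩
  have hlin : ∀ j : ℕ, prf g (n + j + 1)
      ≤ prf g (n + 1) - j * (prf g (n + 1) - prf g (n + 2)) := by
    intro j
    induction j with
    | zero => simp
    | succ j ih =>
      have h1 := (hall j).1
      have h2 : prf g (n + (j + 1) + 1) = prf g (n + j + 2) := rfl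
      rw [h2]
      push_cast
      linarith
  -- The linear descent falls below zero after `j` steps, which contradicts eventual nonnegativity
  -- at `n + max j N`.
  obtain ⟨N, hN⟩ := hg.eventually_prf_nonneg hd hp hpos hS
  obtain ⟨j, hj⟩ := exists_nat_gt (prf g (n + 1) / (prf g (n + 1) - prf g (n + 2)))
  have hgap : 0 < prf g (n + 1) - prf g (n + 2) := sub_pos.2 hdesc
  rw [div_lt_iff₀ hgap] at hj
  have h1 := hlin (max j N)
  have h2 := hN (n + max j N) (by omega)
  have h3 : (j : ℝ) ≤ ((max j N : ℕ) : ℝ) := Nat.cast_le.2 (le_max_left j N)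
  have h4 := mul_le_mul_of_nonneg_right h3 hgap.le
  linarith

end Improvement

end GroupServerQueue

theorem theorem5 {K : ℕ} (q : GroupServerQueue K) (d : ℕ → Fin K → ℕ) (η : ℝ)
    (hd : q.IsOptimal d η) (g : ℕ → ℝ)
    (hg : q.IsPotential d η g ∨ q.SolvesPoisson d η g) :
    (∀ n : ℕ, 1 ≤ n → 0 ≤ GroupServerQueue.prf g n) ∧
    (∀ n : ℕ, 1 ≤ n → GroupServerQueue.prf g n ≤ GroupServerQueue.prf g (n + 1)) := by
  obtain ⟨p, hp, hpos, hs, hS⟩ := hd.exists_balanced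
  have hC : Summable fun m => p m * q.costRate m (d m) :=
    (hS.summable.add (hs.mul_right η)).congr fun m => by ring
  have hg' : q.SolvesPoisson d η g := hg.elim (fun h => h.solvesPoisson hp hd.1 hpos hC) id
  have hmono := hd.monotone_prf hg' hp hpos hs hS
  have h0 : GroupServerQueue.prf g 0 = 0 := sub_self _
  exact ⟨fun n _ => h0 ▸ hmono n.zero_le, fun n _ => hmono n.le_succ⟩
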